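/- There exists a real Banach space $X$ with a normalized weakly null Schauder basis $(e_n)_{n\in\mathbb N}$ such that $X$ is $\ell_2$ saturated and, for every infinite set $M\subseteq\mathbb N$, the subspace $X_M=\overline{\mathrm{span}}\{e_n : n\in M\}$ has nonseparable dual. There also exists a real Banach space $X$ with a normalized weakly null Schauder basis $(e_n)_{n\in\mathbb N}$ such that $X$ is $c_0$ saturated and, for every infinite set $M\subseteq\mathbb N$, the subspace $X_M=\overline{\mathrm{span}}\{e_n : n\in M\}$ has nonseparable dual. Here, normalized means $\|e_n\|=1$ for all $n$; weakly null means that $f(e_n)\to 0$ for every $f\in X^*$; and, for a Banach space $E$, a Banach space $X$ is called $E$ saturated if every closed infinite-dimensional subspace of $X$ contains a closed subspace that is linearly homeomorphic to $E$. -/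

import Mathlib

open Filter Topology
open scoped ZeroAtInfty

/-- The real sequence space `ℓ₂`. -/
abbrev SeqEllTwo : Type := lp (fun _ : ℕ => ℝ) 2

/-- The real sequence space `c₀`: since `ℕ` is discrete, these are the sequences tending to `0`,
with the supremum norm. -/
abbrev SeqCZero : Type := C₀(ℕ, ℝ)

/-- `X` is `E` saturated: every closed infinite dimensional subspace of `X` has a closed subspace
linearly homeomorphic to `E`. -/
def IsSaturatedBy (E X : Type*) [NormedAddCommGroup E] [NormedSpace ℝ E]
    [NormedAddCommGroup X] [NormedSpace ℝ X] : Prop :=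
  ∀ Y : Submodule ℝ X, IsClosed (Y : Set X) → ¬ FiniteDimensional ℝ Y →
    ∃ Z : Submodule ℝ X, Z ≤ Y ∧ IsClosed (Z : Set X) ∧ Nonempty (Z ≃L[ℝ] E)

/-- The sequence `x` converges to `0` in the weak topology of `X`. -/
def IsWeaklyNull {X : Type*} [NormedAddCommGroup X] [NormedSpace ℝ X] (x : ℕ → X) : Prop :=
  ∀ f : StrongDual ℝ X, Tendsto (fun n => f (x n)) atTop (𝓝 0)

/-- The closed linear span of `{x n : n ∈ M}`. -/
def closedSpan {X : Type*} [NormedAddCommGroup X] [NormedSpace ℝ X] (x : ℕ → X) (M : Set ℕ) :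
    Submodule ℝ X :=
  (Submodule.span ℝ (x '' M)).topologicalClosure

/-!
Both spaces are completions of `c₀₀` for norms of James tree type. A *node* is a finite set `I` of
coordinates, and nodes are arranged into finite sequences. An injective coding of the finite
sequences of nodes determines the *level* `j` of each node from the nodes preceding it; a node of
level `j` has at most `sz j` elements and acts as `wt j` times the sum of the coordinates in `I`,
where `wt j` decreases and `wt j * sz j` increases geometrically. A *segment* is the sum of the
functionals of the nodes of a sequence, restricted to an interval of coordinates and to the levels
above a given one. The norm is the supremum of the absolute values of the coordinates and of the
combinations `∑ i, c i • g i` of segments `g i` with pairwise disjoint sets of levels, where either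
`c` belongs to the unit ball of `ℓ₂`, or `|c i| ≤ 1` and the `g i` satisfy a Schreier condition
(at most `N + 1` segments, with coordinates beyond `N`). Restricting to intervals preserves the
norming set, so the unit vectors form a normalized bimonotone basis.

*Nonseparable duals and weak nullity.* The normalized average over a node of level `j` has norm at
most `9 / 7`, because the other levels contribute geometrically decreasing amounts
(`levelBound_decay`). This gives weak nullity. In an infinite set `M` one can choose a dyadic tree
of nodes of full size; the branches define functionals of norm at most `1`, and two branches which
differ have different levels after the point of difference, since the coding is injective. Hence the
functionals of two branches differ by a fixed amount at the average over a node of one of them, and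
the dual of the span of `M` contains an uncountable separated set
(`CoefClass.not_separableSpace_dual_closedSpan`).

*Saturation.* The main point, common to both spaces, is `CoefClass.exists_small_segments`: every
infinite dimensional subspace of `c₀₀` contains normalized vectors far out on which all segments
are small. If not, one first finds normalized blocks with small coordinates, which are then seen by
essentially disjoint ranges of levels, and so their sums of length `n` have norm at least of order
`√n`. Since a sequence of nodes is determined by any level above it, the segments active on a given
block agree on the previous blocks with one of boundedly many sequences
(`CoefClass.exists_controlling_lists`). Taking limits along an ultrafilter one extracts blocks
on which each segment is almost constant up to one exceptional block and almost zero afterwards, so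
that segments remain bounded on alternating sums, a contradiction. Given vectors with small
segments, rapidly chosen blocks are equivalent to the unit vectors of `c₀` or `ℓ₂`: only
boundedly many of the segments of a combination act on a block without being tied to it, and those
contribute little. A perturbation argument
(`NormingSet.isSaturatedBy_of_forall_submodule`) transfers this from `c₀₀` to the closed subspaces
of the completion.
-/

/-! ### Banach spaces defined by norming sets of functionals -/

/-- The space `c₀₀` of finitely supported real sequences. -/
abbrev FinSeq : Type := ℕ →₀ ℝ

/-- Restriction of a finitely supported sequence to the interval `[a, b)`. -/
def window (a b : ℕ) : FinSeq →ₗ[ℝ] FinSeq where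
  toFun x := x.filter (fun i => a ≤ i ∧ i < b)
  map_add' _ _ := Finsupp.filter_add
  map_smul' _ _ := Finsupp.filter_smul

theorem window_apply (a b : ℕ) (x : FinSeq) (i : ℕ) :
    window a b x i = if a ≤ i ∧ i < b then x i else 0 := rfl

/-- `x` is supported in the interval `[a, b)`. -/
def Within (a b : ℕ) (x : FinSeq) : Prop := ∀ i, ¬ (a ≤ i ∧ i < b) → x i = 0

theorem Within.mono {a b a' b' : ℕ} {x : FinSeq} (h : Within a b x) (ha : a' ≤ a) (hb : b ≤ b') :
    Within a' b' x := fun i hi => h i fun h' => hi ⟨ha.trans h'.1, h'.2.trans_le hb⟩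

theorem Within.smul {a b : ℕ} {x : FinSeq} (h : Within a b x) (c : ℝ) : Within a b (c • x) := by
  intro i hi; simp [h i hi]

theorem exists_within_zero (x : FinSeq) : ∃ b, Within 0 b x := by
  obtain ⟨b, hb⟩ := x.support.exists_nat_subset_range
  refine ⟨b, fun i hi => ?_⟩
  by_contra h
  exact hi ⟨Nat.zero_le _, Finset.mem_range.1 (hb (Finsupp.mem_support_iff.2 h))⟩

theorem exists_within {a : ℕ} {x : FinSeq} (h : ∀ i < a, x i = 0) : ∃ b, a ≤ b ∧ Within a b x := by
  obtain ⟨b, hb⟩ := exists_within_zero x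
  refine ⟨max a b, le_max_left _ _, fun i hi => ?_⟩
  rcases lt_or_ge i a with h' | h'
  · exact h i h'
  · refine hb i fun h2 => hi ⟨h', h2.2.trans_le (le_max_right _ _)⟩

theorem Within.window_eq {a b a' b' : ℕ} {x : FinSeq} (h : Within a b x) (ha : a' ≤ a)
    (hb : b ≤ b') : window a' b' x = x := by
  ext i
  rw [window_apply]
  split_ifs with hi
  · rfl
  · exact (h i fun h' => hi ⟨ha.trans h'.1, h'.2.trans_le hb⟩).symm

theorem Within.window_eq_zero {a b a' b' : ℕ} {x : FinSeq} (h : Within a b x)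
    (hab : b' ≤ a ∨ b ≤ a') : window a' b' x = 0 := by
  ext i
  rw [window_apply]
  split_ifs with hi
  · exact h i (by omega)
  · rfl

theorem window_window (a b a' b' : ℕ) (x : FinSeq) :
    window a b (window a' b' x) = window (max a a') (min b b') x := by
  ext i
  simp only [window_apply]
  by_cases h1 : a ≤ i <;> by_cases h2 : i < b <;> by_cases h3 : a' ≤ i <;> by_cases h4 : i < b' <;>
    simp [h1, h2, h3, h4]

/-- `z` is a block sequence: the vectors `z k` have successive supports in `[lo k, hi k)`. -/
def IsBlockSeq (z : ℕ → FinSeq) (lo hi : ℕ → ℕ) : Prop :=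
  (∀ k, Within (lo k) (hi k) (z k)) ∧ ∀ m n, m < n → hi m ≤ lo n

theorem IsBlockSeq.window_eq_zero {z : ℕ → FinSeq} {lo hi : ℕ → ℕ} (h : IsBlockSeq z lo hi)
    {k l : ℕ} (hkl : l ≠ k) : window (lo k) (hi k) (z l) = 0 := by
  rcases lt_or_gt_of_ne hkl with h' | h'
  · exact (h.1 l).window_eq_zero (Or.inr (h.2 _ _ h'))
  · exact (h.1 l).window_eq_zero (Or.inl (h.2 _ _ h'))

theorem IsBlockSeq.window_sum {z : ℕ → FinSeq} {lo hi : ℕ → ℕ} (h : IsBlockSeq z lo hi)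
    (s : Finset ℕ) (c : ℕ → ℝ) {k : ℕ} (hk : k ∈ s) :
    window (lo k) (hi k) (∑ l ∈ s, c l • z l) = c k • z k := by
  rw [map_sum, Finset.sum_eq_single k]
  · rw [map_smul, (h.1 k).window_eq le_rfl le_rfl]
  · intro l _ hl
    rw [map_smul, h.window_eq_zero hl, smul_zero]
  · exact fun h' => absurd hk h'

theorem IsBlockSeq.window_linearCombination {z : ℕ → FinSeq} {lo hi : ℕ → ℕ}
    (h : IsBlockSeq z lo hi) (c : ℕ →₀ ℝ) (k : ℕ) :
    window (lo k) (hi k) (Finsupp.linearCombination ℝ z c) = c k • z k := by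
  rw [Finsupp.linearCombination_apply, Finsupp.sum]
  by_cases hk : k ∈ c.support
  · exact h.window_sum _ _ hk
  · rw [Finsupp.notMem_support_iff.1 hk, zero_smul, map_sum]
    refine Finset.sum_eq_zero fun l hl => ?_
    rw [map_smul, h.window_eq_zero (by rintro rfl; exact hk hl), smul_zero]

/-- A set of linear functionals on `c₀₀` which defines a norm on `c₀₀` for which the unit vectors
form a normalized bimonotone basis: it contains the coordinates, its members are bounded by `1` on
unit vectors, and it is stable under restriction to intervals. -/
structure NormingSet where
  /-- The functionals. -/
  carrier : Set (FinSeq →ₗ[ℝ] ℝ)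
  lapply_mem : ∀ n, Finsupp.lapply n ∈ carrier
  window_mem : ∀ w ∈ carrier, ∀ a b, w ∘ₗ window a b ∈ carrier
  abs_single_le : ∀ w ∈ carrier, ∀ n, |w (Finsupp.single n 1)| ≤ 1

namespace NormingSet

variable (W : NormingSet)

theorem abs_le_sum {w : FinSeq →ₗ[ℝ] ℝ} (hw : w ∈ W.carrier) (x : FinSeq) :
    |w x| ≤ x.sum fun _ c => |c| := by
  conv_lhs => rw [← x.sum_single]
  rw [Finsupp.sum, map_sum]
  refine (Finset.abs_sum_le_sum_abs _ _).trans (Finset.sum_le_sum fun n _ => ?_)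
  have : Finsupp.single n (x n) = x n • Finsupp.single n (1 : ℝ) := by simp
  rw [this, map_smul, smul_eq_mul, abs_mul]
  exact mul_le_of_le_one_right (abs_nonneg _) (W.abs_single_le w hw n)

/-- The map sending `x` to the bounded family of its values at the functionals in `W`. -/
noncomputable def emb : FinSeq →ₗ[ℝ] lp (fun _ : W.carrier => ℝ) ⊤ where
  toFun x := ⟨fun w => w.1 x, memℓp_infty ⟨x.sum fun _ c => |c|, by
    rintro _ ⟨w, rfl⟩; exact W.abs_le_sum w.2 x⟩⟩
  map_add' x y := by ext w; exact map_add w.1 x y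
  map_smul' c x := by ext w; exact map_smul w.1 c x

/-- The norm on `c₀₀` defined by `W`: the supremum of the absolute values of the functionals. -/
noncomputable def nm (x : FinSeq) : ℝ := ‖W.emb x‖

theorem nm_nonneg (x : FinSeq) : 0 ≤ W.nm x := norm_nonneg _

theorem nm_smul (c : ℝ) (x : FinSeq) : W.nm (c • x) = |c| * W.nm x := by
  unfold nm; rw [map_smul, norm_smul, Real.norm_eq_abs]

theorem nm_zero : W.nm 0 = 0 := by simp [nm]

variable {W}

theorem abs_le_nm {w : FinSeq →ₗ[ℝ] ℝ} (hw : w ∈ W.carrier) (x : FinSeq) : |w x| ≤ W.nm x :=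
  lp.norm_apply_le_norm ENNReal.top_ne_zero (W.emb x) ⟨w, hw⟩

theorem abs_apply_le_nm (W : NormingSet) (x : FinSeq) (n : ℕ) : |x n| ≤ W.nm x :=
  abs_le_nm (W.lapply_mem n) x

theorem nm_le {x : FinSeq} {C : ℝ} (hC : 0 ≤ C) (h : ∀ w ∈ W.carrier, |w x| ≤ C) : W.nm x ≤ C :=
  lp.norm_le_of_forall_le hC fun w => h w.1 w.2

theorem exists_lt_abs {x : FinSeq} {r : ℝ} (hr : 0 ≤ r) (h : r < W.nm x) :
    ∃ w ∈ W.carrier, r < |w x| := by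
  by_contra! h'
  exact absurd (nm_le hr h') (not_le.2 h)

theorem nm_window_le (a b : ℕ) (x : FinSeq) : W.nm (window a b x) ≤ W.nm x :=
  nm_le (W.nm_nonneg x) fun w hw => abs_le_nm (W.window_mem w hw a b) x

theorem nm_single (W : NormingSet) (n : ℕ) : W.nm (Finsupp.single n 1) = 1 := by
  refine le_antisymm (nm_le zero_le_one fun w hw => W.abs_single_le w hw n) ?_
  simpa using W.abs_apply_le_nm (Finsupp.single n 1) n

theorem eq_zero_of_nm_eq_zero {x : FinSeq} (h : W.nm x = 0) : x = 0 := by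
  ext n
  have := W.abs_apply_le_nm x n
  rw [h] at this
  simpa using this

theorem nm_pos {x : FinSeq} (h : x ≠ 0) : 0 < W.nm x :=
  lt_of_le_of_ne (W.nm_nonneg x) fun h' => h (eq_zero_of_nm_eq_zero h'.symm)

theorem abs_le_nm_linearCombination {z : ℕ → FinSeq} {lo hi : ℕ → ℕ} (h : IsBlockSeq z lo hi)
    (hz : ∀ k, W.nm (z k) = 1) (c : ℕ →₀ ℝ) (k : ℕ) :
    |c k| ≤ W.nm (Finsupp.linearCombination ℝ z c) := by
  have := W.nm_window_le (lo k) (hi k) (Finsupp.linearCombination ℝ z c)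
  rwa [h.window_linearCombination, nm_smul, hz, mul_one] at this

variable (W)

/-- The completion of `c₀₀` for the norm defined by `W`, realized as a closed subspace of the
space of bounded functions on `W`. -/
def Space : Type := (LinearMap.range W.emb).topologicalClosure

noncomputable instance : NormedAddCommGroup W.Space :=
  inferInstanceAs (NormedAddCommGroup (LinearMap.range W.emb).topologicalClosure)

noncomputable instance : NormedSpace ℝ W.Space :=
  inferInstanceAs (NormedSpace ℝ (LinearMap.range W.emb).topologicalClosure)

/-- The inclusion of `c₀₀` in its completion. -/
noncomputable def inc : FinSeq →ₗ[ℝ] W.Space :=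
  W.emb.codRestrict (LinearMap.range W.emb).topologicalClosure fun x =>
    Submodule.le_topologicalClosure _ ⟨x, rfl⟩

instance : CompleteSpace W.Space :=
  (Submodule.isClosed_topologicalClosure _).completeSpace_coe

theorem norm_inc (x : FinSeq) : ‖W.inc x‖ = W.nm x := rfl

/-- A functional of the norming set, as a continuous functional on the completion. -/
noncomputable def eval (w : W.carrier) : StrongDual ℝ W.Space :=
  (lp.evalCLM ℝ (fun _ : W.carrier => ℝ) ⊤ w).comp
    (LinearMap.range W.emb).topologicalClosure.subtypeL

theorem eval_inc (w : W.carrier) (x : FinSeq) : W.eval w (W.inc x) = w.1 x := rfl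

theorem abs_eval_le (w : W.carrier) (y : W.Space) : |W.eval w y| ≤ ‖y‖ :=
  lp.norm_apply_le_norm ENNReal.top_ne_zero y.1 w

theorem norm_le_of_eval {y : W.Space} {C : ℝ} (hC : 0 ≤ C) (h : ∀ w, |W.eval w y| ≤ C) :
    ‖y‖ ≤ C :=
  lp.norm_le_of_forall_le hC h

theorem denseRange_inc : DenseRange W.inc := by
  intro y
  refine closure_subtype.2 (closure_mono ?_ y.2)
  rintro _ ⟨x, rfl⟩
  exact ⟨_, ⟨x, rfl⟩, rfl⟩

/-- The coordinate functionals on the completion. -/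
noncomputable def coord (n : ℕ) : StrongDual ℝ W.Space := W.eval ⟨_, W.lapply_mem n⟩

theorem coord_inc (n : ℕ) (x : FinSeq) : W.coord n (W.inc x) = x n := rfl

theorem window_eq_sum (b : ℕ) (x : FinSeq) :
    window 0 b x = ∑ n ∈ Finset.range b, x n • Finsupp.single n (1 : ℝ) := by
  ext i
  simp [window_apply, Finsupp.finsetSum_apply, Finsupp.single_apply]

theorem eval_window (w : W.carrier) (b : ℕ) (y : W.Space) :
    W.eval ⟨_, W.window_mem w.1 w.2 0 b⟩ y =
      W.eval w (∑ n ∈ Finset.range b, W.coord n y • W.inc (Finsupp.single n 1)) := by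
  simp only [map_sum, map_smul, eval_inc, smul_eq_mul]
  refine W.denseRange_inc.induction_on
    (p := fun y => W.eval ⟨_, W.window_mem w.1 w.2 0 b⟩ y =
      ∑ n ∈ Finset.range b, W.coord n y * w.1 (Finsupp.single n 1)) y
    (isClosed_eq (by fun_prop) (by fun_prop)) fun x => ?_
  simp only [coord_inc]
  rw [eval_inc, LinearMap.comp_apply, window_eq_sum]
  simp only [map_sum, map_smul, smul_eq_mul]

theorem norm_partial_sum_le (b : ℕ) (y : W.Space) :
    ‖∑ n ∈ Finset.range b, W.coord n y • W.inc (Finsupp.single n 1)‖ ≤ ‖y‖ :=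
  W.norm_le_of_eval (norm_nonneg _) fun w => by
    rw [← eval_window]; exact W.abs_eval_le _ _

theorem partial_sum_inc (b : ℕ) (x : FinSeq) :
    ∑ n ∈ Finset.range b, W.coord n (W.inc x) • W.inc (Finsupp.single n 1) =
      W.inc (window 0 b x) := by
  simp only [coord_inc]
  rw [window_eq_sum, map_sum]
  simp only [map_smul]

theorem tendsto_partial_sum (y : W.Space) :
    Tendsto (fun b => ∑ n ∈ Finset.range b, W.coord n y • W.inc (Finsupp.single n 1)) atTop
      (𝓝 y) := by
  rw [Metric.tendsto_atTop]
  intro δ hδ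
  obtain ⟨x, hx⟩ := W.denseRange_inc.exists_dist_lt y (half_pos hδ)
  obtain ⟨B, hB⟩ := exists_within_zero x
  refine ⟨B, fun b hb => ?_⟩
  have h1 := W.norm_partial_sum_le b (y - W.inc x)
  simp only [map_sub, sub_smul, Finset.sum_sub_distrib] at h1
  rw [partial_sum_inc, hB.window_eq le_rfl hb] at h1
  rw [dist_eq_norm] at hx ⊢
  set S := ∑ n ∈ Finset.range b, W.coord n y • W.inc (Finsupp.single n 1)
  calc ‖S - y‖ = ‖(S - W.inc x) - (y - W.inc x)‖ := by congr 1; abel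
    _ ≤ ‖S - W.inc x‖ + ‖y - W.inc x‖ := norm_sub_le _ _
    _ < δ := by linarith

/-- The unit vectors, as a Schauder basis of the completion. -/
noncomputable def basis : SchauderBasis ℝ W.Space where
  basis n := W.inc (Finsupp.single n 1)
  coord := W.coord
  ortho i j := by
    rw [coord_inc]
    by_cases h : i = j
    · subst h; simp
    · simp [Finsupp.single_eq_of_ne h, Pi.single, Function.update, h]
  expansion y := by
    rw [HasSum, SummationFilter.conditional_filter_eq_map_range, tendsto_map'_iff]
    exact W.tendsto_partial_sum y

theorem basis_apply (n : ℕ) : W.basis n = W.inc (Finsupp.single n 1) := rfl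

theorem norm_basis (n : ℕ) : ‖W.basis n‖ = 1 := W.nm_single n

end NormingSet

/-! ### Reduction of saturation to finitely supported sequences -/

theorem exists_ne_zero_of_not_finiteDimensional {E : Type*} [AddCommGroup E] [Module ℝ E]
    (h : ¬ FiniteDimensional ℝ E) {N : ℕ} (T : E →ₗ[ℝ] (Fin N → ℝ)) : ∃ x, x ≠ 0 ∧ T x = 0 := by
  by_contra! H
  exact h (FiniteDimensional.of_injective T ((injective_iff_map_eq_zero T).2 fun x hx => by
    by_contra h0; exact H x h0 hx))

/-- A positive tolerance which is below a given bound and at most half of finitely many others. -/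
theorem exists_tolerance {α : Type*} (s : Finset α) (ρ : α → ℝ) (hρ : ∀ d ∈ s, 0 < ρ d)
    {c : ℝ} (hc : 0 < c) : ∃ r, 0 < r ∧ r ≤ c ∧ ∀ d ∈ s, r ≤ ρ d / 2 := by
  have : ∀ᶠ r : ℝ in 𝓝[>] 0, r ≤ c ∧ ∀ d ∈ s, r ≤ ρ d / 2 := by
    refine Filter.Eventually.and ?_ ((Filter.eventually_all_finset s).2 fun d hd => ?_)
    · exact nhdsWithin_le_nhds (eventually_le_nhds hc)
    · exact nhdsWithin_le_nhds (eventually_le_nhds (half_pos (hρ d hd)))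
  obtain ⟨r, h1, h2⟩ := (this.and self_mem_nhdsWithin).exists
  exact ⟨r, h2, h1.1, h1.2⟩

/-- Halving tolerances: if each `ρ` is at most half of the previous ones and the first is at most
`c`, all partial sums are at most `2 * c`. -/
theorem sum_le_of_halving {ρ : ℕ → ℝ} {c : ℝ} (hc : ∀ k, ρ k ≤ c) (hρ : ∀ k, 0 ≤ ρ k)
    (h : ∀ m n, m < n → ρ n ≤ ρ m / 2) (s : Finset ℕ) : ∑ k ∈ s, ρ k ≤ 2 * c := by
  have hc0 : 0 ≤ c := (hρ 0).trans (hc 0)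
  have hgeo : ∀ k, ρ k ≤ c * (1 / 2) ^ k := by
    intro k
    induction k with
    | zero => simpa using hc 0
    | succ k ih =>
      have := h k (k + 1) k.lt_succ_self
      rw [pow_succ]; linarith
  calc ∑ k ∈ s, ρ k ≤ ∑ k ∈ s, c * (1 / 2) ^ k := Finset.sum_le_sum fun k _ => hgeo k
    _ ≤ ∑' k : ℕ, c * (1 / 2 : ℝ) ^ k :=
        (summable_geometric_two.mul_left c).sum_le_tsum _ fun k _ => by positivity
    _ = 2 * c := by rw [tsum_mul_left, tsum_geometric_two]; ring

namespace NormingSet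

variable (W : NormingSet)

/-- An infinite dimensional subspace of the completion contains vectors arbitrarily close to
normalized finitely supported sequences with support arbitrarily far out. -/
theorem exists_near_block (Y : Submodule ℝ W.Space) (hY : ¬ FiniteDimensional ℝ Y) (N : ℕ)
    {ρ : ℝ} (hρ : 0 < ρ) : ∃ (z : FinSeq) (y : W.Space) (b : ℕ), N ≤ b ∧ Within N b z ∧
      W.nm z = 1 ∧ y ∈ Y ∧ ‖y - W.inc z‖ ≤ ρ := by
  obtain ⟨y₀, hy0, hker⟩ := exists_ne_zero_of_not_finiteDimensional hY
    (LinearMap.pi fun n : Fin N => (W.coord n).toLinearMap ∘ₗ Y.subtype)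
  have hc0 : ∀ n < N, W.coord n y₀.1 = 0 := fun n hn => congrFun hker ⟨n, hn⟩
  have hpos : 0 < ‖y₀.1‖ := norm_pos_iff.2 fun h => hy0 (Subtype.ext h)
  set y : W.Space := ‖y₀.1‖⁻¹ • y₀.1 with hy
  have hyn : ‖y‖ = 1 := by rw [hy, norm_smul, norm_inv, norm_norm, inv_mul_cancel₀ hpos.ne']
  have hyc : ∀ n < N, W.coord n y = 0 := fun n hn => by rw [hy, map_smul, hc0 n hn, smul_zero]
  set δ := min ρ 1 / 8 with hδ
  have hδpos : 0 < δ := by positivity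
  have hδρ : 8 * δ ≤ ρ := by rw [hδ]; linarith [min_le_left ρ 1]
  have hδ1 : 8 * δ ≤ 1 := by rw [hδ]; linarith [min_le_right ρ 1]
  obtain ⟨x, hx⟩ := W.denseRange_inc.exists_dist_lt y hδpos
  rw [dist_eq_norm] at hx
  have hwin : W.nm (window 0 N x) ≤ δ := by
    refine nm_le hδpos.le fun w hw => ?_
    have h1 := W.abs_eval_le ⟨_, W.window_mem w hw 0 N⟩ (y - W.inc x)
    have h2 := W.eval_window ⟨w, hw⟩ N y
    rw [Finset.sum_eq_zero (fun n hn => by rw [hyc n (Finset.mem_range.1 hn), zero_smul]),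
      map_zero] at h2
    rw [map_sub, h2, eval_inc, zero_sub, abs_neg] at h1
    exact h1.trans hx.le
  set z₀ := x - window 0 N x with hz₀
  have hz₀y : ‖y - W.inc z₀‖ ≤ 2 * δ := by
    have : y - W.inc z₀ = (y - W.inc x) + W.inc (window 0 N x) := by
      rw [hz₀, map_sub]; abel
    rw [this]
    refine (norm_add_le _ _).trans ?_
    rw [norm_inc]; linarith
  have hz₀n : |W.nm z₀ - 1| ≤ 2 * δ := by
    rw [← hyn, ← norm_inc, abs_sub_comm]
    exact (abs_norm_sub_norm_le _ _).trans hz₀y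
  obtain ⟨b, hNb, hb⟩ := exists_within (a := N) (x := z₀) (fun i hi => by
    simp [hz₀, window_apply, hi])
  have hz₀pos : 0 < W.nm z₀ := by linarith [(abs_le.1 hz₀n).1]
  refine ⟨(W.nm z₀)⁻¹ • z₀, y, b, hNb, hb.smul _, ?_, Y.smul_mem _ y₀.2, ?_⟩
  · rw [nm_smul, abs_of_pos (inv_pos.2 hz₀pos), inv_mul_cancel₀ hz₀pos.ne']
  · have h3 : W.inc z₀ - W.inc ((W.nm z₀)⁻¹ • z₀) = W.inc ((1 - (W.nm z₀)⁻¹) • z₀) := by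
      rw [sub_smul, one_smul, ← map_sub]
    have h4 : ‖W.inc z₀ - W.inc ((W.nm z₀)⁻¹ • z₀)‖ ≤ 2 * δ := by
      rw [h3, norm_inc, nm_smul]
      calc |1 - (W.nm z₀)⁻¹| * W.nm z₀ = |(1 - (W.nm z₀)⁻¹) * W.nm z₀| := by
            rw [abs_mul, abs_of_pos hz₀pos]
        _ = |W.nm z₀ - 1| := by rw [sub_mul, inv_mul_cancel₀ hz₀pos.ne', one_mul]
        _ ≤ 2 * δ := hz₀n
    have h5 : y - W.inc ((W.nm z₀)⁻¹ • z₀) = (y - W.inc z₀) +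
      (W.inc z₀ - W.inc ((W.nm z₀)⁻¹ • z₀)) := by abel
    rw [h5]
    refine (norm_add_le _ _).trans ?_
    linarith

/-- An infinite dimensional subspace `Y` of the completion is, up to a small perturbation,
spanned by a normalized block sequence. -/
theorem exists_block_perturbation (Y : Submodule ℝ W.Space) (hY : ¬ FiniteDimensional ℝ Y) :
    ∃ (z : FinSeq →ₗ[ℝ] FinSeq) (y : FinSeq →ₗ[ℝ] W.Space), Function.Injective z ∧
      (∀ a, y a ∈ Y) ∧ ∀ a, ‖y a - W.inc (z a)‖ ≤ W.nm (z a) / 2 := by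
  obtain ⟨f, hf, hr⟩ := exists_seq_of_forall_finset_exists
    (α := FinSeq × W.Space × ℕ × ℕ × ℝ)
    (fun d => Within d.2.2.1 d.2.2.2.1 d.1 ∧ W.nm d.1 = 1 ∧ d.2.1 ∈ Y ∧
      ‖d.2.1 - W.inc d.1‖ ≤ d.2.2.2.2 ∧ 0 < d.2.2.2.2 ∧ d.2.2.2.2 ≤ 1 / 4)
    (fun d d' => d.2.2.2.1 ≤ d'.2.2.1 ∧ d'.2.2.2.2 ≤ d.2.2.2.2 / 2) (by
      intro s hs
      obtain ⟨N, hN⟩ : ∃ N, ∀ d ∈ s, d.2.2.2.1 ≤ N :=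
        ⟨s.sup fun d => d.2.2.2.1, fun d hd => Finset.le_sup (f := fun d => d.2.2.2.1) hd⟩
      obtain ⟨ρ, hρ, hρ4, hρs⟩ := exists_tolerance s (fun d => d.2.2.2.2)
        (fun d hd => (hs d hd).2.2.2.2.1) (by norm_num : (0 : ℝ) < 1 / 4)
      obtain ⟨z, y, b, -, hb, hz, hy, hyz⟩ := W.exists_near_block Y hY N hρ
      exact ⟨(z, y, N, b, ρ), ⟨hb, hz, hy, hyz, hρ, hρ4⟩, fun d hd => ⟨hN d hd, hρs d hd⟩⟩)
  have hblock : IsBlockSeq (fun k => (f k).1) (fun k => (f k).2.2.1) fun k => (f k).2.2.2.1 :=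
    ⟨fun k => (hf k).1, fun m n hmn => (hr m n hmn).1⟩
  have hcoef := abs_le_nm_linearCombination hblock (W := W) fun k => (hf k).2.1
  refine ⟨Finsupp.linearCombination ℝ fun k => (f k).1,
    Finsupp.linearCombination ℝ fun k => (f k).2.1, ?_, ?_, ?_⟩
  · rw [injective_iff_map_eq_zero]
    intro a ha
    ext k
    have := hcoef a k
    rw [ha, nm_zero] at this
    simpa using this
  · intro a
    rw [Finsupp.linearCombination_apply, Finsupp.sum]
    exact Y.sum_mem fun k _ => Y.smul_mem _ (hf k).2.2.1
  · intro a
    have h1 := sum_le_of_halving (c := 1 / 4) (fun k => (hf k).2.2.2.2.2)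
      (fun k => (hf k).2.2.2.2.1.le) (fun m n hmn => (hr m n hmn).2) a.support
    have h2 := hcoef a
    set Z := Finsupp.linearCombination ℝ (fun k => (f k).1) a with hZ
    have h3 : Finsupp.linearCombination ℝ (fun k => (f k).2.1) a - W.inc Z =
        ∑ k ∈ a.support, a k • ((f k).2.1 - W.inc (f k).1) := by
      rw [hZ, Finsupp.linearCombination_apply, Finsupp.linearCombination_apply, Finsupp.sum,
        Finsupp.sum, map_sum, ← Finset.sum_sub_distrib]
      refine Finset.sum_congr rfl fun k _ => ?_
      rw [map_smul, smul_sub]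
    rw [h3]
    calc ‖∑ k ∈ a.support, a k • ((f k).2.1 - W.inc (f k).1)‖
        ≤ ∑ k ∈ a.support, W.nm Z * (f k).2.2.2.2 := by
          refine (norm_sum_le _ _).trans (Finset.sum_le_sum fun k _ => ?_)
          rw [norm_smul]
          exact mul_le_mul (h2 k) (hf k).2.2.2.1 (norm_nonneg _) (W.nm_nonneg _)
      _ = W.nm Z * ∑ k ∈ a.support, (f k).2.2.2.2 := by rw [Finset.mul_sum]
      _ ≤ W.nm Z / 2 := by nlinarith [W.nm_nonneg Z]

/-- The completion is `E` saturated as soon as every infinite dimensional subspace of `c₀₀`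
contains an isomorphic copy of a dense subspace of `E` parametrized by `c₀₀`. -/
theorem isSaturatedBy_of_forall_submodule {E : Type*} [NormedAddCommGroup E] [NormedSpace ℝ E]
    [CompleteSpace E] (d : FinSeq →ₗ[ℝ] E) (hd : DenseRange d)
    (H : ∀ V : Submodule ℝ FinSeq, ¬ FiniteDimensional ℝ V → ∃ (u : FinSeq →ₗ[ℝ] FinSeq) (c C : ℝ),
      0 < c ∧ (∀ a, u a ∈ V) ∧ (∀ a, c * ‖d a‖ ≤ W.nm (u a)) ∧ ∀ a, W.nm (u a) ≤ C * ‖d a‖) :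
    IsSaturatedBy E W.Space := by
  intro Y hYc hY
  obtain ⟨z, y, hz, hyY, hyz⟩ := W.exists_block_perturbation Y hY
  have hinf : ¬ FiniteDimensional ℝ (LinearMap.range z) := by
    intro hfin
    have : FiniteDimensional ℝ FinSeq :=
      Module.Finite.equiv (LinearEquiv.ofInjective z hz).symm
    have h := (Finsupp.basisSingleOne (R := ℝ) (ι := ℕ)).linearIndependent.finite
    exact not_finite ℕ
  obtain ⟨u, c, C, hc, huV, hlow, hup⟩ := H _ hinf
  obtain ⟨g, hg⟩ := z.exists_leftInverse_of_injective (LinearMap.ker_eq_bot.2 hz)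
  have hzg : ∀ a, z (g (u a)) = u a := by
    intro a
    obtain ⟨b, hb⟩ := huV a
    rw [← hb, show g (z b) = b from LinearMap.congr_fun hg b]
  set v : FinSeq →ₗ[ℝ] W.Space := y ∘ₗ g ∘ₗ u with hv
  have hvu : ∀ a, ‖v a - W.inc (u a)‖ ≤ W.nm (u a) / 2 := by
    intro a
    have := hyz (g (u a))
    rwa [hzg] at this
  have hvup : ∀ a, ‖v a‖ ≤ (3 / 2 * C) * ‖d a‖ := by
    intro a
    have h1 := norm_le_norm_add_norm_sub' (v a) (W.inc (u a))
    rw [norm_inc] at h1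
    linarith [hvu a, hup a]
  have hvlow : ∀ a, c / 2 * ‖d a‖ ≤ ‖v a‖ := by
    intro a
    have h1 := norm_le_norm_add_norm_sub (v a) (W.inc (u a))
    rw [norm_inc] at h1
    linarith [hvu a, hlow a]
  set T : E →L[ℝ] W.Space := v.extendOfNorm d with hT
  have hTd : ∀ a, T (d a) = v a := LinearMap.extendOfNorm_eq hd ⟨_, hvup⟩
  have hTlow : ∀ e, c / 2 * ‖e‖ ≤ ‖T e‖ := by
    intro e
    refine hd.induction_on (p := fun e => c / 2 * ‖e‖ ≤ ‖T e‖) e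
      (isClosed_le (by fun_prop) (by fun_prop)) fun a => ?_
    rw [hTd]; exact hvlow a
  have hTY : ∀ e, T e ∈ Y := by
    intro e
    refine hd.induction_on (p := fun e => T e ∈ Y) e (hYc.preimage T.continuous) fun a => ?_
    rw [hTd]; exact hyY _
  have hanti : AntilipschitzWith (Real.toNNReal (2 / c)) T := by
    refine AddMonoidHomClass.antilipschitz_of_bound T fun e => ?_
    rw [Real.coe_toNNReal _ (by positivity), div_mul_eq_mul_div, le_div_iff₀ hc]
    linarith [hTlow e]
  have hclosed : IsClosed (Set.range T) := hanti.isClosed_range T.uniformContinuous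
  refine ⟨LinearMap.range T.toLinearMap, ?_, ?_, ⟨?_⟩⟩
  · rintro _ ⟨e, rfl⟩; exact hTY e
  · simpa using! hclosed
  · exact (T.equivRange hanti.injective hclosed).symm

end NormingSet

/-! ### Tree functionals and the coding of their levels -/

/-- The code of a node sequence. Sequences are stored with the most recent node at the head, and
the code of a sequence `L` is the level of every node `I` that may be added to it. -/
def code (L : List (Finset ℕ)) : ℕ := Encodable.encode L

theorem code_injective : Function.Injective code := Encodable.encode_injective

theorem code_lt_code_cons (I : Finset ℕ) (L : List (Finset ℕ)) : code L < code (I :: L) := by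
  unfold code
  rw [Encodable.encode_list_cons]
  exact Nat.lt_succ_of_le (Nat.right_le_pair _ _)

theorem length_le_code (L : List (Finset ℕ)) : L.length ≤ code L := by
  induction L with
  | nil => exact Nat.zero_le _
  | cons I L ih => exact ih.trans_lt (code_lt_code_cons I L)

/-- The weight of the nodes of level `j`. -/
noncomputable def wt (j : ℕ) : ℝ := (1 / 8) ^ (j + 1)

/-- The maximal cardinality of the nodes of level `j`. -/
def sz (j : ℕ) : ℕ := 64 ^ (j + 1)

theorem wt_pos (j : ℕ) : 0 < wt j := by unfold wt; positivity

theorem sz_pos (j : ℕ) : 0 < sz j := by unfold sz; positivity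

theorem wt_mul_sz (j : ℕ) : wt j * sz j = 8 ^ (j + 1) := by
  unfold wt sz
  push_cast
  rw [← mul_pow]; norm_num

theorem summable_wt : Summable wt := by
  have : wt = fun j => (1 / 8 : ℝ) ^ j * (1 / 8) := by ext j; rw [wt, pow_succ]
  rw [this]
  exact (summable_geometric_of_lt_one (by norm_num) (by norm_num)).mul_right _

theorem sum_wt_le (s : Finset ℕ) : ∑ j ∈ s, wt j ≤ 1 / 7 := by
  refine (summable_wt.sum_le_tsum s fun j _ => (wt_pos j).le).trans ?_
  have : wt = fun j => (1 / 8 : ℝ) ^ j * (1 / 8) := by ext j; rw [wt, pow_succ]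
  rw [this, tsum_mul_right, tsum_geometric_of_lt_one (by norm_num) (by norm_num)]
  norm_num

/-- The functional given by the nodes of `L` of level at least `lo`: a node `I` of level `j`
contributes `wt j` times the sum of the coordinates in `I`. -/
noncomputable def treeFn : List (Finset ℕ) → ℕ → FinSeq →ₗ[ℝ] ℝ
  | [], _ => 0
  | I :: L, lo => treeFn L lo +
      if lo ≤ code L then wt (code L) • ∑ i ∈ I, Finsupp.lapply i else 0

/-- The levels, at least `lo`, of the nodes of `L`. -/
def levels : List (Finset ℕ) → ℕ → Finset ℕ
  | [], _ => ∅
  | _ :: L, lo => levels L lo ∪ if lo ≤ code L then {code L} else ∅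

/-- Every node of `L` has at most as many elements as its level permits. -/
def Admissible : List (Finset ℕ) → Prop
  | [] => True
  | I :: L => I.card ≤ sz (code L) ∧ Admissible L

theorem lt_code_of_mem_levels {L : List (Finset ℕ)} {lo j : ℕ} (h : j ∈ levels L lo) :
    j < code L := by
  induction L with
  | nil => simp [levels] at h
  | cons I L ih =>
    rw [levels, Finset.mem_union] at h
    rcases h with h | h
    · exact (ih h).trans (code_lt_code_cons I L)
    · split_ifs at h
      · rw [Finset.mem_singleton.1 h]; exact code_lt_code_cons I L
      · simp at h

theorem le_of_mem_levels {L : List (Finset ℕ)} {lo j : ℕ} (h : j ∈ levels L lo) : lo ≤ j := by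
  induction L with
  | nil => simp [levels] at h
  | cons I L ih =>
    rw [levels, Finset.mem_union] at h
    rcases h with h | h
    · exact ih h
    · split_ifs at h with h'
      · rwa [Finset.mem_singleton.1 h]
      · simp at h

theorem exists_suffix_of_mem_levels {L : List (Finset ℕ)} {lo j : ℕ} (h : j ∈ levels L lo) :
    ∃ I Q, (I :: Q) <:+ L ∧ code Q = j := by
  induction L with
  | nil => simp [levels] at h
  | cons I L ih =>
    rw [levels, Finset.mem_union] at h
    rcases h with h | h
    · obtain ⟨J, Q, hQ, hj⟩ := ih h
      exact ⟨J, Q, hQ.trans (List.suffix_cons I L), hj⟩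
    · split_ifs at h with h'
      · exact ⟨I, L, List.suffix_rfl, (Finset.mem_singleton.1 h).symm⟩
      · simp at h

theorem treeFn_eq_zero {L : List (Finset ℕ)} {lo : ℕ} (h : code L ≤ lo) : treeFn L lo = 0 := by
  induction L with
  | nil => rfl
  | cons I L ih =>
    have h1 := (code_lt_code_cons I L).trans_le h
    rw [treeFn, ih h1.le, if_neg (not_le.2 h1), add_zero]

theorem exists_treeFn_eq_sub {L : List (Finset ℕ)} (hL : Admissible L) (lo : ℕ) :
    ∃ L', Admissible L' ∧ treeFn L lo = treeFn L 0 - treeFn L' 0 := by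
  induction L with
  | nil => exact ⟨[], trivial, by simp [treeFn]⟩
  | cons I L ih =>
    obtain ⟨L', hL', h⟩ := ih hL.2
    by_cases hlo : lo ≤ code L
    · refine ⟨L', hL', ?_⟩
      rw [treeFn, treeFn, h, if_pos hlo, if_pos (Nat.zero_le _)]
      abel
    · refine ⟨I :: L, hL, ?_⟩
      rw [sub_self, treeFn, if_neg hlo, treeFn_eq_zero (not_le.1 hlo).le, add_zero]

theorem treeFn_eq_add_of_suffix {L Q : List (Finset ℕ)} {I : Finset ℕ} (h : (I :: Q) <:+ L) :
    treeFn L 0 = treeFn Q 0 + treeFn L (code Q) := by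
  induction L with
  | nil => simp at h
  | cons J L ih =>
    rcases List.suffix_cons_iff.1 h with h | h
    · obtain ⟨rfl, rfl⟩ := List.cons.inj h
      rw [treeFn, treeFn, treeFn_eq_zero le_rfl, if_pos (Nat.zero_le _), if_pos le_rfl, zero_add]
    · have h1 : code Q ≤ code L := by
        have : ∀ {P : List (Finset ℕ)}, Q <:+ P → code Q ≤ code P := by
          intro P hP
          induction P with
          | nil => rw [List.suffix_nil.1 hP]
          | cons K P ihP =>
            rcases List.suffix_cons_iff.1 hP with hP | hP
            · rw [hP]
            · exact (ihP hP).trans (code_lt_code_cons K P).le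
        exact this ((List.suffix_cons I Q).trans h)
      rw [treeFn, treeFn, ih h, if_pos (Nat.zero_le _), if_pos h1, add_assoc]

/-- `B j` bounds the contribution to `x` of any single node of level `j`. -/
def LevelBound (x : FinSeq) (B : ℕ → ℝ) : Prop :=
  ∀ j (I : Finset ℕ), I.card ≤ sz j → wt j * |∑ i ∈ I, x i| ≤ B j

namespace LevelBound

variable {x : FinSeq} {B : ℕ → ℝ}

theorem nonneg (h : LevelBound x B) (j : ℕ) : 0 ≤ B j := by
  simpa using h j ∅ (by simp)

theorem of_abs_le {S : ℝ} (h : ∀ i, |x i| ≤ S) : LevelBound x fun j => wt j * sz j * S := by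
  intro j I hI
  have hS : 0 ≤ S := (abs_nonneg _).trans (h 0)
  have h1 : |∑ i ∈ I, x i| ≤ sz j * S := by
    refine (Finset.abs_sum_le_sum_abs _ _).trans ((Finset.sum_le_sum fun i _ => h i).trans ?_)
    rw [Finset.sum_const, nsmul_eq_mul]
    exact mul_le_mul_of_nonneg_right (by exact_mod_cast hI) hS
  simp only [mul_assoc]
  exact mul_le_mul_of_nonneg_left h1 (wt_pos j).le

theorem of_sum_abs (x : FinSeq) : LevelBound x fun j => wt j * ∑ i ∈ x.support, |x i| := by
  intro j I _
  refine mul_le_mul_of_nonneg_left ((Finset.abs_sum_le_sum_abs _ _).trans ?_) (wt_pos j).le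
  rw [← Finset.sum_filter_add_sum_filter_not I (· ∈ x.support)]
  have h1 : ∑ i ∈ I with ¬ i ∈ x.support, |x i| = 0 :=
    Finset.sum_eq_zero fun i hi => by
      rw [Finsupp.notMem_support_iff.1 (Finset.mem_filter.1 hi).2, abs_zero]
  rw [h1, add_zero]
  exact Finset.sum_le_sum_of_subset_of_nonneg (fun i hi => (Finset.mem_filter.1 hi).2)
    fun _ _ _ => abs_nonneg _

theorem window (h : LevelBound x B) (a b : ℕ) : LevelBound (window a b x) B := by
  intro j I hI
  simp only [window_apply]
  rw [← Finset.sum_filter]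
  exact h j _ ((Finset.card_filter_le _ _).trans hI)

/-- The nodes of level in `[lo, lo')` contribute at most the sum of the bounds at their levels. -/
theorem abs_treeFn_sub_le (h : LevelBound x B) {L : List (Finset ℕ)} (hL : Admissible L)
    {lo lo' : ℕ} (hlo : lo ≤ lo') :
    |treeFn L lo x - treeFn L lo' x| ≤ ∑ j ∈ levels L lo \ levels L lo', B j := by
  induction L with
  | nil => simp [treeFn, levels]
  | cons I L ih =>
    have hmem : ∀ l, code L ∉ levels L l := fun l h' => lt_irrefl _ (lt_code_of_mem_levels h')
    have ih' := ih hL.2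
    by_cases h1 : lo' ≤ code L
    · have h2 : levels (I :: L) lo \ levels (I :: L) lo' = levels L lo \ levels L lo' := by
        rw [levels, levels, if_pos (hlo.trans h1), if_pos h1]
        ext j
        simp only [Finset.mem_sdiff, Finset.mem_union, Finset.mem_singleton]
        constructor
        · tauto
        · rintro ⟨h3, h4⟩
          refine ⟨Or.inl h3, ?_⟩
          rintro (h5 | rfl)
          exacts [h4 h5, hmem _ h3]
      rw [h2, treeFn, treeFn, if_pos (hlo.trans h1), if_pos h1]
      simpa using ih'
    · by_cases h2 : lo ≤ code L
      · have h3 : levels (I :: L) lo \ levels (I :: L) lo' =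
            insert (code L) (levels L lo \ levels L lo') := by
          rw [levels, levels, if_pos h2, if_neg h1]
          ext j
          simp only [Finset.mem_sdiff, Finset.mem_union, Finset.mem_singleton, Finset.mem_insert,
            Finset.notMem_empty, or_false]
          constructor
          · tauto
          · rintro (rfl | h4)
            exacts [⟨Or.inr rfl, hmem _⟩, ⟨Or.inl h4.1, h4.2⟩]
        rw [h3, Finset.sum_insert (by simp [hmem]), treeFn, treeFn, if_pos h2, if_neg h1]
        have h4 := h (code L) I hL.1
        rw [← abs_of_pos (wt_pos (code L)), ← abs_mul] at h4
        have h5 : (treeFn L lo + wt (code L) • ∑ i ∈ I, Finsupp.lapply i : FinSeq →ₗ[ℝ] ℝ) x -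
            (treeFn L lo' + 0) x =
            wt (code L) * (∑ i ∈ I, x i) + (treeFn L lo x - treeFn L lo' x) := by
          simp [LinearMap.sum_apply]; ring
        rw [h5]
        exact (abs_add_le _ _).trans (add_le_add h4 ih')
      · have h3 : levels (I :: L) lo \ levels (I :: L) lo' = levels L lo \ levels L lo' := by
          rw [levels, levels, if_neg h1, if_neg h2, Finset.union_empty, Finset.union_empty]
        rw [h3, treeFn, treeFn, if_neg h1, if_neg h2]
        simpa using ih'

theorem abs_treeFn_le (h : LevelBound x B) {L : List (Finset ℕ)} (hL : Admissible L) (lo : ℕ) :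
    |treeFn L lo x| ≤ ∑ j ∈ levels L lo, B j := by
  have h1 := h.abs_treeFn_sub_le hL (le_max_left lo (code L))
  rw [treeFn_eq_zero (le_max_right _ _)] at h1
  simp only [LinearMap.zero_apply, sub_zero] at h1
  exact h1.trans (Finset.sum_le_sum_of_subset_of_nonneg Finset.sdiff_subset
    fun j _ _ => h.nonneg j)

end LevelBound

/-- A segment: an admissible node sequence, restricted to the levels at least `lo` and to the
coordinates in `[a, b)`. -/
structure Seg where
  /-- The node sequence. -/
  list : List (Finset ℕ)
  adm : Admissible list
  /-- The least level allowed. -/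
  lo : ℕ
  /-- The left end of the interval of coordinates. -/
  a : ℕ
  /-- The right end of the interval of coordinates. -/
  b : ℕ

namespace Seg

/-- The functional defined by a segment. -/
noncomputable def fn (g : Seg) : FinSeq →ₗ[ℝ] ℝ := treeFn g.list g.lo ∘ₗ window g.a g.b

/-- The levels occurring in a segment. -/
def lev (g : Seg) : Finset ℕ := levels g.list g.lo

/-- The restriction of a segment to an interval of coordinates. -/
def restrict (g : Seg) (a b : ℕ) : Seg := ⟨g.list, g.adm, g.lo, max g.a a, min g.b b⟩

theorem fn_restrict (g : Seg) (a b : ℕ) : (g.restrict a b).fn = g.fn ∘ₗ window a b := by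
  refine LinearMap.ext fun x => ?_
  simp only [fn, restrict, LinearMap.comp_apply, window_window]

theorem fn_eq_zero (g : Seg) {a b : ℕ} {x : FinSeq} (hx : Within a b x) (h : b ≤ g.a ∨ g.b ≤ a) :
    g.fn x = 0 := by
  rw [fn, LinearMap.comp_apply, hx.window_eq_zero h.symm, map_zero]

theorem abs_fn_le (g : Seg) {x : FinSeq} {B : ℕ → ℝ} (h : LevelBound x B) :
    |g.fn x| ≤ ∑ j ∈ g.lev, B j :=
  (h.window g.a g.b).abs_treeFn_le g.adm g.lo

end Seg

/-- A class of coefficient families: `mem ι c N` says that `c` may be used to combine segments,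
indexed by `ι`, with coordinates in `[N, ∞)`. -/
structure CoefClass where
  /-- The relation defining the class. -/
  mem : ∀ (ι : Type) [Fintype ι], (ι → ℝ) → ℕ → Prop
  abs_le : ∀ (ι : Type) [Fintype ι] (c : ι → ℝ) (N : ℕ), mem ι c N → ∀ i, |c i| ≤ 1
  flat : ∀ (ι : Type) [Fintype ι] (c : ι → ℝ) (N : ℕ), Fintype.card ι ≤ N + 1 →
    (∀ i, c i ^ 2 * Fintype.card ι ≤ 1) → mem ι c N

namespace CoefClass

/-- Combinations of segments with pairwise disjoint levels, with coefficients in the class. -/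
def IsComb (K : CoefClass) (w : FinSeq →ₗ[ℝ] ℝ) : Prop :=
  ∃ (ι : Type) (_ : Fintype ι) (g : ι → Seg) (c : ι → ℝ) (N : ℕ), K.mem ι c N ∧
    (∀ i, N ≤ (g i).a) ∧ Pairwise (fun i j => Disjoint (g i).lev (g j).lev) ∧
    w = ∑ i, c i • (g i).fn

variable (K : CoefClass)

theorem isComb_zero : K.IsComb 0 :=
  ⟨Empty, inferInstance, Empty.elim, Empty.elim, 0, K.flat _ _ _ (by simp) (fun i => i.elim),
    fun i => i.elim, fun i => i.elim, by simp⟩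

theorem isComb_fn (g : Seg) : K.IsComb g.fn :=
  ⟨Unit, inferInstance, fun _ => g, fun _ => 1, 0, K.flat _ _ _ (by simp) (by simp),
    fun _ => Nat.zero_le _, fun i j h => absurd (Subsingleton.elim i j) h, by simp⟩

variable {K}

theorem IsComb.window {w : FinSeq →ₗ[ℝ] ℝ} (h : K.IsComb w) (a b : ℕ) :
    K.IsComb (w ∘ₗ window a b) := by
  obtain ⟨ι, _, g, c, N, hc, hN, hd, rfl⟩ := h
  refine ⟨ι, _, fun i => (g i).restrict a b, c, N, hc, fun i => (hN i).trans (le_max_left _ _),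
    hd, ?_⟩
  refine LinearMap.ext fun x => ?_
  simp [Seg.fn_restrict, LinearMap.sum_apply]

theorem sum_abs_fn_le {ι : Type} [Fintype ι] {g : ι → Seg}
    (hd : Pairwise (fun i j => Disjoint (g i).lev (g j).lev)) {x : FinSeq} {B : ℕ → ℝ}
    (h : LevelBound x B) (s : Finset ι) :
    ∑ i ∈ s, |(g i).fn x| ≤ ∑ j ∈ s.biUnion fun i => (g i).lev, B j := by
  rw [Finset.sum_biUnion fun i _ j _ hij => hd hij]
  exact Finset.sum_le_sum fun i _ => (g i).abs_fn_le h

theorem IsComb.abs_le {w : FinSeq →ₗ[ℝ] ℝ} (hw : K.IsComb w) {x : FinSeq} {B : ℕ → ℝ} {D : ℝ}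
    (h : LevelBound x B) (hD : ∀ s : Finset ℕ, ∑ j ∈ s, B j ≤ D) : |w x| ≤ D := by
  obtain ⟨ι, _, g, c, N, hc, hN, hd, rfl⟩ := hw
  refine le_trans ?_ ((sum_abs_fn_le hd h Finset.univ).trans (hD _))
  rw [LinearMap.sum_apply]
  refine (Finset.abs_sum_le_sum_abs _ _).trans (Finset.sum_le_sum fun i _ => ?_)
  rw [LinearMap.smul_apply, smul_eq_mul, abs_mul]
  exact mul_le_of_le_one_left (abs_nonneg _) (K.abs_le _ _ _ hc i)

theorem levelBound_single (n : ℕ) : LevelBound (Finsupp.single n 1) wt := by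
  intro j I _
  refine mul_le_of_le_one_right (wt_pos j).le ?_
  rw [show ∑ i ∈ I, Finsupp.single n (1 : ℝ) i = if n ∈ I then 1 else 0 by
    simp [Finsupp.single_apply]]
  split_ifs <;> simp

variable (K)

/-- The norming set given by the coordinates and the combinations of segments. -/
def normingSet : NormingSet where
  carrier := {w | (∃ n, w = Finsupp.lapply n) ∨ K.IsComb w}
  lapply_mem n := Or.inl ⟨n, rfl⟩
  window_mem := by
    rintro w (⟨n, rfl⟩ | hw) a b
    · by_cases hn : a ≤ n ∧ n < b
      · refine Or.inl ⟨n, ?_⟩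
        refine LinearMap.ext fun x => ?_
        simp [window_apply, hn]
      · right
        convert! K.isComb_zero
        refine LinearMap.ext fun x => ?_
        simp [window_apply, hn]
    · exact Or.inr (hw.window a b)
  abs_single_le := by
    rintro w (⟨n, rfl⟩ | hw) m
    · by_cases h : n = m
      · subst h; simp
      · simp [Finsupp.single_eq_of_ne h]
    · exact hw.abs_le (levelBound_single m) fun s => (sum_wt_le s).trans (by norm_num)

variable {K}

theorem IsComb.mem {w : FinSeq →ₗ[ℝ] ℝ} (h : K.IsComb w) : w ∈ K.normingSet.carrier := Or.inr h

theorem abs_fn_le_nm (K : CoefClass) (g : Seg) (x : FinSeq) : |g.fn x| ≤ K.normingSet.nm x :=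
  NormingSet.abs_le_nm (K.isComb_fn g).mem x

theorem nm_le_of_levelBound {x : FinSeq} {B : ℕ → ℝ} {D : ℝ} (h : LevelBound x B)
    (hD : ∀ s : Finset ℕ, ∑ j ∈ s, B j ≤ D) (hx : ∀ i, |x i| ≤ D) : K.normingSet.nm x ≤ D := by
  refine NormingSet.nm_le ((abs_nonneg _).trans (hx 0)) ?_
  rintro w (⟨n, rfl⟩ | hw)
  · exact hx n
  · exact hw.abs_le h hD

theorem treeFn_eq_fn {L : List (Finset ℕ)} (hL : Admissible L) (lo : ℕ) {b : ℕ} {x : FinSeq}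
    (hx : Within 0 b x) : treeFn L lo x = (Seg.mk L hL lo 0 b).fn x := by
  rw [Seg.fn, LinearMap.comp_apply, hx.window_eq le_rfl le_rfl]

theorem abs_treeFn_le_nm (K : CoefClass) {L : List (Finset ℕ)} (hL : Admissible L) (lo : ℕ)
    (x : FinSeq) : |treeFn L lo x| ≤ K.normingSet.nm x := by
  obtain ⟨b, hb⟩ := exists_within_zero x
  rw [treeFn_eq_fn hL lo hb]
  exact K.abs_fn_le_nm _ _

/-- Segments far out satisfy a lower estimate of order `√n`. -/
theorem sum_abs_fn_le_sqrt_mul (K : CoefClass) {ι : Type} [Fintype ι] [Nonempty ι] {g : ι → Seg}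
    (hd : Pairwise (fun i j => Disjoint (g i).lev (g j).lev))
    (ha : ∀ i, Fintype.card ι ≤ (g i).a + 1) (x : FinSeq) :
    ∑ i, |(g i).fn x| ≤ √(Fintype.card ι) * K.normingSet.nm x := by
  have hpos : (0 : ℝ) < √(Fintype.card ι) := Real.sqrt_pos.2 (by exact_mod_cast Fintype.card_pos)
  set c : ι → ℝ := fun i => SignType.sign ((g i).fn x) * (√(Fintype.card ι))⁻¹ with hc
  have hmem : K.IsComb (∑ i, c i • (g i).fn) := by
    refine ⟨ι, _, g, c, Fintype.card ι - 1, K.flat _ _ _ (by omega) fun i => ?_,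
      fun i => by have := ha i; omega, hd, rfl⟩
    have h1 : (SignType.sign ((g i).fn x) : ℝ) ^ 2 ≤ 1 := by
      rcases lt_trichotomy ((g i).fn x) 0 with h | h | h <;> simp [h]
    rw [hc]
    simp only
    rw [mul_pow, inv_pow, Real.sq_sqrt (Nat.cast_nonneg _), mul_assoc, inv_mul_cancel₀, mul_one]
    · exact h1
    · exact_mod_cast Fintype.card_ne_zero
  have h2 := NormingSet.abs_le_nm hmem.mem x
  have h3 : (∑ i, c i • (g i).fn) x = (∑ i, |(g i).fn x|) * (√(Fintype.card ι))⁻¹ := by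
    rw [LinearMap.sum_apply, Finset.sum_mul]
    refine Finset.sum_congr rfl fun i _ => ?_
    rw [LinearMap.smul_apply, smul_eq_mul, hc]
    simp only
    rw [mul_right_comm, sign_mul_self]
  rw [h3] at h2
  have h4 := (le_abs_self _).trans h2
  rwa [← div_eq_mul_inv, div_le_iff₀ hpos, mul_comm] at h4

end CoefClass

/-! ### Averages of the basis, weak nullity and nonseparable duals -/

theorem exists_tendsto_hyperfilter {v : ℕ → ℝ} {C : ℝ} (h : ∀ n, |v n| ≤ C) :
    ∃ l, |l| ≤ C ∧ Tendsto v (hyperfilter ℕ) (𝓝 l) := by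
  obtain ⟨l, hl, hle⟩ := (isCompact_Icc (a := -C) (b := C)).ultrafilter_le_nhds
    ((hyperfilter ℕ).map v) (by
      rw [le_principal_iff]
      exact Filter.mem_map.2 (Filter.univ_mem' fun n => abs_le.1 (h n)))
  exact ⟨l, abs_le.2 hl, hle⟩

/-- The contribution of level `k` to a normalized average over a node of level `j`. -/
noncomputable def decay (j k : ℕ) : ℝ :=
  if k < j then wt (j - k - 1) else if j < k then wt (k - j - 1) else 1

theorem decay_nonneg (j k : ℕ) : 0 ≤ decay j k := by
  unfold decay
  split_ifs
  exacts [(wt_pos _).le, (wt_pos _).le, zero_le_one]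

theorem sum_decay_le {j : ℕ} {s : Finset ℕ} (hj : j ∉ s) : ∑ k ∈ s, decay j k ≤ 2 / 7 := by
  rw [← Finset.sum_filter_add_sum_filter_not s (· < j)]
  have h1 : ∑ k ∈ s with k < j, decay j k = ∑ k ∈ s with k < j, wt (j - k - 1) :=
    Finset.sum_congr rfl fun k hk => by rw [decay, if_pos (Finset.mem_filter.1 hk).2]
  have h2 : ∑ k ∈ s with ¬ k < j, decay j k = ∑ k ∈ s with ¬ k < j, wt (k - j - 1) :=
    Finset.sum_congr rfl fun k hk => by
      have hk' := Finset.mem_filter.1 hk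
      have : k ≠ j := by rintro rfl; exact hj hk'.1
      rw [decay, if_neg hk'.2, if_pos (by omega)]
  have h3 : ∑ k ∈ s with k < j, wt (j - k - 1) ≤ 1 / 7 := by
    rw [← Finset.sum_image (g := fun k => j - k - 1) (f := wt)]
    · exact sum_wt_le _
    · intro a ha b hb hab
      have ha' := (Finset.mem_filter.1 ha).2
      have hb' := (Finset.mem_filter.1 hb).2
      simp only at hab
      omega
  have h4 : ∑ k ∈ s with ¬ k < j, wt (k - j - 1) ≤ 1 / 7 := by
    rw [← Finset.sum_image (g := fun k => k - j - 1) (f := wt)]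
    · exact sum_wt_le _
    · intro a ha b hb hab
      have ha' := Finset.mem_filter.1 ha
      have hb' := Finset.mem_filter.1 hb
      have h1 : a ≠ j := by rintro rfl; exact hj ha'.1
      have h2 : b ≠ j := by rintro rfl; exact hj hb'.1
      simp only at hab
      omega
  rw [h1, h2]; linarith

theorem sum_decay_le' (j : ℕ) (s : Finset ℕ) : ∑ k ∈ s, decay j k ≤ 9 / 7 := by
  have h1 : ∑ k ∈ s, decay j k ≤ ∑ k ∈ insert j (s.erase j), decay j k :=
    Finset.sum_le_sum_of_subset_of_nonneg
      (fun k hk => by by_cases h : k = j <;> simp [h, hk]) fun k _ _ => decay_nonneg j k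
  rw [Finset.sum_insert (Finset.notMem_erase _ _)] at h1
  have h2 := sum_decay_le (Finset.notMem_erase j s)
  have h3 : decay j j = 1 := by simp [decay]
  linarith

/-- Vectors with at most `sz j` coordinates, all bounded by `(wt j * sz j)⁻¹`, are essentially
only seen by the nodes of level `j`. -/
theorem levelBound_decay {j : ℕ} {x : FinSeq} {I : Finset ℕ} (hI : I.card ≤ sz j)
    (hxI : ∀ i, i ∉ I → x i = 0) (hx : ∀ i, |x i| ≤ ((8 : ℝ) ^ (j + 1))⁻¹) :
    LevelBound x (decay j) := by
  intro k J hJ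
  have h1 : |∑ i ∈ J, x i| ≤ ((J ∩ I).card : ℝ) * ((8 : ℝ) ^ (j + 1))⁻¹ := by
    rw [← Finset.sum_subset (Finset.inter_subset_left (s₁ := J) (s₂ := I))
      fun i hi hi' => hxI i fun h => hi' (Finset.mem_inter.2 ⟨hi, h⟩)]
    refine (Finset.abs_sum_le_sum_abs _ _).trans ?_
    rw [← nsmul_eq_mul]
    exact Finset.sum_le_card_nsmul _ _ _ fun i _ => hx i
  have hcJ : ((J ∩ I).card : ℝ) ≤ sz k := by
    exact_mod_cast (Finset.card_le_card Finset.inter_subset_left).trans hJ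
  have hcI : ((J ∩ I).card : ℝ) ≤ sz j := by
    exact_mod_cast (Finset.card_le_card Finset.inter_subset_right).trans hI
  have hpos : (0 : ℝ) < 8 ^ (j + 1) := by positivity
  refine (mul_le_mul_of_nonneg_left h1 (wt_pos k).le).trans ?_
  rw [← mul_assoc, ← div_eq_mul_inv, div_le_iff₀ hpos]
  unfold decay
  split_ifs with h2 h3
  · refine (mul_le_mul_of_nonneg_left hcJ (wt_pos k).le).trans ?_
    rw [wt_mul_sz]
    have : j = k + (j - k - 1) + 1 := by omega
    generalize j - k - 1 = m at this
    subst this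
    have h4 : (1 / 8 : ℝ) ^ (m + 1) * 8 ^ (m + 1) = 1 := by rw [← mul_pow]; norm_num
    rw [wt, show k + m + 1 + 1 = (m + 1) + (k + 1) by ring, pow_add 8 (m + 1), ← mul_assoc, h4,
      one_mul]
  · refine (mul_le_mul_of_nonneg_left hcI (wt_pos k).le).trans ?_
    have : k = j + (k - j - 1) + 1 := by omega
    generalize k - j - 1 = m at this
    subst this
    have h4 : wt (j + m + 1) = wt m * wt j := by
      rw [wt, wt, wt, ← pow_add]; congr 1; omega
    rw [h4, mul_assoc, wt_mul_sz]
  · obtain rfl : k = j := by omega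
    refine (mul_le_mul_of_nonneg_left hcI (wt_pos k).le).trans ?_
    rw [wt_mul_sz, one_mul]

namespace CoefClass

variable (K : CoefClass)

/-- If a functional `f` were at least `δ` in absolute value on infinitely many unit vectors, its
values at signed averages over `sz j` of them would be of order `δ * 8 ^ (j + 1)`, although these
averages, in the normalization used here, have norm at most `9 / 7`. -/
theorem isWeaklyNull_basis : IsWeaklyNull fun n => K.normingSet.basis n := by
  intro f
  simp only [NormingSet.basis_apply]
  by_contra hf
  rw [Metric.tendsto_atTop] at hf
  push Not at hf
  obtain ⟨δ, hδ, hf⟩ := hf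
  set e : ℕ → K.normingSet.Space := fun n => K.normingSet.inc (Finsupp.single n 1) with he
  have hinf : {n | δ ≤ |f (e n)|}.Infinite := by
    rw [Set.infinite_iff_exists_gt]
    intro N
    obtain ⟨n, hn, h⟩ := hf (N + 1)
    exact ⟨n, by simpa using h, hn⟩
  obtain ⟨j, hj⟩ := pow_unbounded_of_one_lt (‖f‖ * (9 / 7) / δ) (by norm_num : (1 : ℝ) < 8)
  obtain ⟨I, hIM, hIc⟩ := hinf.exists_subset_card_eq (sz j)
  set x : FinSeq := ∑ i ∈ I, (SignType.sign (f (e i)) * ((8 : ℝ) ^ (j + 1))⁻¹) •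
    Finsupp.single i (1 : ℝ) with hx
  have hxi : ∀ i, x i = if i ∈ I then SignType.sign (f (e i)) * ((8 : ℝ) ^ (j + 1))⁻¹ else 0 := by
    intro i
    simp [hx, Finsupp.finsetSum_apply, Finsupp.single_apply]
  have hsign : ∀ r : ℝ, |(SignType.sign r : ℝ)| ≤ 1 := fun r => by
    rcases lt_trichotomy r 0 with h | h | h <;> simp [h]
  have hpos : (0 : ℝ) < ((8 : ℝ) ^ (j + 1))⁻¹ := by positivity
  have hxle : ∀ i, |x i| ≤ ((8 : ℝ) ^ (j + 1))⁻¹ := by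
    intro i
    rw [hxi]
    split_ifs
    · rw [abs_mul, abs_of_pos hpos]
      exact mul_le_of_le_one_left hpos.le (hsign _)
    · rw [abs_zero]; exact hpos.le
  have hnm : K.normingSet.nm x ≤ 9 / 7 := by
    refine nm_le_of_levelBound (levelBound_decay hIc.le (fun i hi => by rw [hxi, if_neg hi]) hxle)
      (sum_decay_le' j) fun i => (hxle i).trans ?_
    exact (inv_le_one_of_one_le₀ (one_le_pow₀ (by norm_num))).trans (by norm_num)
  have hfx : f (K.normingSet.inc x) = ∑ i ∈ I, |f (e i)| * ((8 : ℝ) ^ (j + 1))⁻¹ := by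
    rw [hx, map_sum, map_sum]
    refine Finset.sum_congr rfl fun i _ => ?_
    rw [map_smul, map_smul, smul_eq_mul, mul_right_comm, sign_mul_self]
  have h1 : (sz j : ℝ) * (δ * ((8 : ℝ) ^ (j + 1))⁻¹) ≤ f (K.normingSet.inc x) := by
    rw [hfx, ← hIc, ← nsmul_eq_mul]
    exact Finset.card_nsmul_le_sum _ _ _ fun i hi =>
      mul_le_mul_of_nonneg_right (hIM hi) hpos.le
  have h2 : f (K.normingSet.inc x) ≤ ‖f‖ * (9 / 7) :=
    (le_abs_self _).trans ((f.le_opNorm _).trans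
      (mul_le_mul_of_nonneg_left hnm (norm_nonneg _)))
  have h3 : (sz j : ℝ) * ((8 : ℝ) ^ (j + 1))⁻¹ = 8 ^ (j + 1) := by
    rw [← div_eq_mul_inv, div_eq_iff (by positivity), sz]
    push_cast
    rw [← mul_pow]; norm_num
  rw [div_lt_iff₀ hδ] at hj
  have h4 : (8 : ℝ) ^ j * δ ≤ 8 ^ (j + 1) * δ :=
    mul_le_mul_of_nonneg_right (pow_le_pow_right₀ (by norm_num) (Nat.le_succ _)) hδ.le
  have h5 : (sz j : ℝ) * (δ * ((8 : ℝ) ^ (j + 1))⁻¹) = 8 ^ (j + 1) * δ := by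
    rw [mul_left_comm, h3, mul_comm]
  linarith

end CoefClass

theorem treeFn_apply_eq_zero {L : List (Finset ℕ)} {x : FinSeq} (h : ∀ J ∈ L, ∀ i ∈ J, x i = 0)
    (lo : ℕ) : treeFn L lo x = 0 := by
  induction L with
  | nil => rfl
  | cons I L ih =>
    rw [treeFn, LinearMap.add_apply, ih fun J hJ => h J (List.mem_cons_of_mem _ hJ), zero_add]
    split_ifs
    · simp only [LinearMap.smul_apply, LinearMap.sum_apply, Finsupp.lapply_apply]
      rw [Finset.sum_eq_zero (h I List.mem_cons_self), smul_zero]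
    · rfl

/-- In an infinite set one can choose two different nodes of full size which continue a given node
sequence. -/
theorem exists_children {M : Set ℕ} (hM : M.Infinite) (Q : List (Finset ℕ)) :
    ∃ I : Bool → Finset ℕ, Function.Injective I ∧ ∀ b, (I b).card = sz (code Q) ∧ ↑(I b) ⊆ M ∧
      ∀ J ∈ Q, Disjoint (I b) J := by
  have key : ∀ F : Finset ℕ, ∃ I : Finset ℕ, I.card = sz (code Q) ∧ ↑I ⊆ M ∧ Disjoint I F := by
    intro F
    obtain ⟨I, hI, hc⟩ := (hM.sdiff F.finite_toSet).exists_subset_card_eq (sz (code Q))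
    refine ⟨I, hc, fun i hi => (hI hi).1, Finset.disjoint_left.2 fun i hi => ?_⟩
    simpa using (hI hi).2
  obtain ⟨I₀, hc0, hM0, hd0⟩ := key (Q.toFinset.biUnion id)
  obtain ⟨I₁, hc1, hM1, hd1⟩ := key (Q.toFinset.biUnion id ∪ I₀)
  rw [Finset.disjoint_union_right] at hd1
  have hne : I₁ ≠ I₀ := by
    rintro rfl
    have h1 := Finset.disjoint_self_iff_empty _ |>.1 hd1.2
    rw [h1, Finset.card_empty] at hc1
    exact (sz_pos _).ne hc1
  have hsub : ∀ J ∈ Q, J ⊆ Q.toFinset.biUnion id := fun J hJ =>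
    Finset.subset_biUnion_of_mem (u := id) (List.mem_toFinset.2 hJ)
  refine ⟨fun b => bif b then I₁ else I₀, ?_, ?_⟩
  · rintro (_ | _) (_ | _) h
    · rfl
    · exact absurd h.symm hne
    · exact absurd h hne
    · rfl
  · rintro (_ | _)
    · exact ⟨hc0, hM0, fun J hJ => hd0.mono_right (hsub J hJ)⟩
    · exact ⟨hc1, hM1, fun J hJ => hd1.1.mono_right (hsub J hJ)⟩

/-- The dyadic tree of node sequences obtained by choosing the node `I Q b` to continue `Q`;
the sequence `branch I α n` consists of the first `n` nodes of the branch `α`. -/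
def branch (I : List (Finset ℕ) → Bool → Finset ℕ) (α : ℕ → Bool) : ℕ → List (Finset ℕ)
  | 0 => []
  | n + 1 => I (branch I α n) (α n) :: branch I α n

theorem length_branch (I : List (Finset ℕ) → Bool → Finset ℕ) (α : ℕ → Bool) (n : ℕ) :
    (branch I α n).length = n := by
  induction n with
  | zero => rfl
  | succ n ih => rw [branch, List.length_cons, ih]

theorem eq_of_branch_eq {I : List (Finset ℕ) → Bool → Finset ℕ}
    (hI : ∀ Q, Function.Injective (I Q)) {α β : ℕ → Bool} {n : ℕ}
    (h : branch I α n = branch I β n) : ∀ k < n, α k = β k := by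
  induction n with
  | zero => intro k hk; omega
  | succ n ih =>
    rw [branch, branch] at h
    obtain ⟨h1, h2⟩ := List.cons.inj h
    intro k hk
    rcases Nat.lt_succ_iff_lt_or_eq.1 hk with hk | rfl
    · exact ih h2 k hk
    · rw [h2] at h1; exact hI _ h1

theorem exists_branch_eq_of_suffix {I : List (Finset ℕ) → Bool → Finset ℕ} {α : ℕ → Bool} {n : ℕ}
    {J : Finset ℕ} {Q : List (Finset ℕ)} (h : (J :: Q) <:+ branch I α n) :
    ∃ k, Q = branch I α k := by
  induction n with
  | zero => simp [branch] at h
  | succ n ih =>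
    rw [branch] at h
    rcases List.suffix_cons_iff.1 h with h | h
    · exact ⟨n, (List.cons.inj h).2⟩
    · exact ih h

theorem admissible_branch {I : List (Finset ℕ) → Bool → Finset ℕ}
    (hI : ∀ Q b, (I Q b).card = sz (code Q)) (α : ℕ → Bool) (n : ℕ) :
    Admissible (branch I α n) := by
  induction n with
  | zero => trivial
  | succ n ih => exact ⟨(hI _ _).le, ih⟩

/-- A sequence of functionals dominated by the norm has a limit in the dual, along an ultrafilter;
its values lie in every closed set which eventually contains those of the sequence. -/
theorem NormingSet.exists_dual_limit (W : NormingSet) (φ : ℕ → FinSeq →ₗ[ℝ] ℝ)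
    (h : ∀ n x, |φ n x| ≤ W.nm x) : ∃ F : StrongDual ℝ W.Space, ∀ x (C : Set ℝ), IsClosed C →
      (∀ᶠ n in atTop, φ n x ∈ C) → F (W.inc x) ∈ C := by
  choose ψ hψ hlim using fun x => exists_tendsto_hyperfilter fun n => h n x
  let ψ' : FinSeq →ₗ[ℝ] ℝ :=
    { toFun := ψ
      map_add' := fun x y => tendsto_nhds_unique (hlim (x + y)) (by
        simpa only [map_add] using (hlim x).add (hlim y))
      map_smul' := fun c x => tendsto_nhds_unique (hlim (c • x)) (by
        simpa only [map_smul, RingHom.id_apply] using (hlim x).const_smul c) }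
  refine ⟨ψ'.extendOfNorm W.inc, fun x C hC hx => ?_⟩
  rw [LinearMap.extendOfNorm_eq W.denseRange_inc ⟨1, fun x => by
    rw [one_mul]; exact hψ x⟩]
  exact hC.mem_of_tendsto (hlim x) (Nat.hyperfilter_le_atTop hx)

theorem not_separableSpace_of_separated {E : Type*} [NormedAddCommGroup E] {δ : ℝ} (hδ : 0 < δ)
    (G : (ℕ → Bool) → E) (hG : ∀ α β, α ≠ β → δ ≤ ‖G α - G β‖) :
    ¬ TopologicalSpace.SeparableSpace E := by
  intro hsep
  have hc : Countable (ℕ → Bool) := by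
    refine Pairwise.countable_of_isOpen_disjoint (s := fun α => Metric.ball (G α) (δ / 2)) ?_
      (fun _ => Metric.isOpen_ball) fun α => ⟨G α, Metric.mem_ball_self (half_pos hδ)⟩
    intro α β hαβ
    refine Metric.ball_disjoint_ball ?_
    rw [dist_eq_norm]
    linarith [hG α β hαβ]
  obtain ⟨f, hf⟩ := exists_surjective_nat (ℕ → Bool)
  obtain ⟨n, hn⟩ := hf fun n => !f n n
  simpa using congrFun hn n

namespace CoefClass

variable (K : CoefClass)

/-- The branches of a dyadic tree of full size nodes in `M` define functionals on `X_M`; those of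
two different branches are separated by the average over a node of one of them that comes after the
branches have split. -/
theorem not_separableSpace_dual_closedSpan {M : Set ℕ} (hM : M.Infinite) :
    ¬ TopologicalSpace.SeparableSpace
      (StrongDual ℝ (closedSpan (fun n => K.normingSet.basis n) M)) := by
  choose I hIinj hI using fun Q => exists_children hM Q
  have hadm := admissible_branch (I := I) fun Q b => (hI Q b).1
  choose F hF using fun α => K.normingSet.exists_dual_limit (fun n => treeFn (branch I α n) 0)
    fun n x => K.abs_treeFn_le_nm (hadm α n) 0 x
  refine not_separableSpace_of_separated (δ := 5 / 9) (by norm_num)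
    (fun α => (F α).comp (Submodule.subtypeL _)) fun α β hαβ => ?_
  obtain ⟨k, hk⟩ := Function.ne_iff.1 hαβ
  set n := k + 1 with hn
  -- The average over the node of `α` following the first point of difference.
  set Q := branch I α n with hQ
  set J := I Q (α n) with hJ
  set c : ℝ := ((8 : ℝ) ^ (code Q + 1))⁻¹ with hc
  have hcpos : 0 < c := by positivity
  set x : FinSeq := ∑ i ∈ J, c • Finsupp.single i (1 : ℝ) with hx
  have hxi : ∀ i, x i = if i ∈ J then c else 0 := by
    intro i
    simp [hx, Finsupp.finsetSum_apply, Finsupp.single_apply]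
  have hxle : ∀ i, |x i| ≤ c := by
    intro i
    rw [hxi]
    split_ifs
    · rw [abs_of_pos hcpos]
    · simpa using hcpos.le
  have hLB : LevelBound x (decay (code Q)) :=
    levelBound_decay (hI Q _).1.le (fun i hi => by rw [hxi, if_neg hi]) hxle
  have hnm : K.normingSet.nm x ≤ 9 / 7 := by
    refine nm_le_of_levelBound hLB (sum_decay_le' _) fun i => (hxle i).trans ?_
    exact (inv_le_one_of_one_le₀ (one_le_pow₀ (by norm_num))).trans (by norm_num)
  have hFα : F α (K.normingSet.inc x) = 1 := by
    refine hF α x {1} isClosed_singleton (eventually_atTop.2 ⟨n + 1, fun m hm => ?_⟩)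
    induction m, hm using Nat.le_induction with
    | base =>
      rw [Set.mem_singleton_iff, branch, treeFn, LinearMap.add_apply, if_pos (Nat.zero_le _),
        treeFn_apply_eq_zero, zero_add, LinearMap.smul_apply, LinearMap.sum_apply]
      · simp only [Finsupp.lapply_apply, ← hQ, ← hJ]
        rw [Finset.sum_congr rfl fun i hi => by rw [hxi, if_pos hi], Finset.sum_const, hJ,
          (hI Q _).1, nsmul_eq_mul, smul_eq_mul, ← mul_assoc, wt_mul_sz, hc,
          mul_inv_cancel₀ (by positivity)]
      · intro J' hJ' i hi
        rw [hxi, if_neg fun h => Finset.disjoint_left.1 ((hI Q (α n)).2.2 J' hJ') h hi]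
    | succ m hm ih =>
      rw [Set.mem_singleton_iff] at ih ⊢
      have hmem : ∀ m, n + 1 ≤ m → J ∈ branch I α m := by
        intro m hm
        induction m, hm using Nat.le_induction with
        | base => exact List.mem_cons_self
        | succ m _ ih => exact List.mem_cons_of_mem _ ih
      rw [branch, treeFn, LinearMap.add_apply, if_pos (Nat.zero_le _), ih,
        LinearMap.smul_apply, LinearMap.sum_apply, Finset.sum_eq_zero, smul_zero, add_zero]
      intro i hi
      rw [Finsupp.lapply_apply, hxi,
        if_neg fun h => Finset.disjoint_left.1 ((hI _ (α m)).2.2 J (hmem m hm)) hi h]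
  have hFβ : F β (K.normingSet.inc x) ∈ Set.Iic (2 / 7 : ℝ) := by
    refine hF β x _ isClosed_Iic (Eventually.of_forall fun m => ?_)
    refine (le_abs_self _).trans ((hLB.abs_treeFn_le (hadm β m) 0).trans (sum_decay_le ?_))
    intro hmem
    obtain ⟨J', Q', hsuf, hcode⟩ := exists_suffix_of_mem_levels hmem
    obtain ⟨l, hl⟩ := exists_branch_eq_of_suffix hsuf
    rw [code_injective hcode, hQ] at hl
    have hlen := congrArg List.length hl
    rw [length_branch, length_branch] at hlen
    rw [← hlen] at hl
    exact hk (eq_of_branch_eq hIinj hl k (by omega))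
  have hxmem : K.normingSet.inc x ∈ closedSpan (fun n => K.normingSet.basis n) M := by
    refine Submodule.le_topologicalClosure _ ?_
    rw [hx, map_sum]
    refine Submodule.sum_mem _ fun i hi => ?_
    rw [map_smul]
    exact Submodule.smul_mem _ _ (Submodule.subset_span ⟨i, (hI Q (α n)).2.1 hi, rfl⟩)
  set G := (F α).comp (closedSpan (fun n => K.normingSet.basis n) M).subtypeL -
    (F β).comp (closedSpan (fun n => K.normingSet.basis n) M).subtypeL with hG
  have h1 := G.le_opNorm ⟨_, hxmem⟩
  have h2 : G ⟨_, hxmem⟩ = F α (K.normingSet.inc x) - F β (K.normingSet.inc x) := rfl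
  rw [h2, hFα] at h1
  have h3 : ‖(⟨_, hxmem⟩ : closedSpan (fun n => K.normingSet.basis n) M)‖ ≤ 9 / 7 := hnm
  have h4 := h1.trans (mul_le_mul_of_nonneg_left h3 (norm_nonneg G))
  have h5 := (le_abs_self _).trans h4
  have h6 : F β (K.normingSet.inc x) ≤ 2 / 7 := hFβ
  linarith

end CoefClass

/-! ### Vectors on which all segments are small -/

theorem IsBlockSeq.sum_apply {z : ℕ → FinSeq} {lo hi : ℕ → ℕ} (h : IsBlockSeq z lo hi)
    {s : Finset ℕ} (c : ℕ → ℝ) {k : ℕ} (hk : k ∈ s) {i : ℕ} (hi : z k i ≠ 0) :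
    (∑ l ∈ s, c l • z l) i = c k * z k i := by
  have h1 := DFunLike.congr_fun (h.window_sum s c hk) i
  rwa [window_apply, if_pos (not_not.1 fun h' => hi (h.1 k i h'))] at h1

theorem mem_levels_of_le {L : List (Finset ℕ)} {lo lo' j : ℕ} (h : j ∈ levels L lo)
    (hj : lo' ≤ j) : j ∈ levels L lo' := by
  induction L with
  | nil => simp [levels] at h
  | cons I L ih =>
    rw [levels, Finset.mem_union] at h ⊢
    rcases h with h | h
    · exact Or.inl (ih h)
    · right
      split_ifs at h
      · rw [Finset.mem_singleton.1 h] at hj ⊢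
        rw [if_pos hj]; exact Finset.mem_singleton_self _
      · simp at h

/-- Omitting the nodes of level below `l` from a segment. -/
def Seg.raise (g : Seg) (l : ℕ) : Seg := ⟨g.list, g.adm, max g.lo l, g.a, g.b⟩

theorem Seg.abs_fn_sub_raise_le (g : Seg) (l : ℕ) {x : FinSeq} {B : ℕ → ℝ} (h : LevelBound x B) :
    |g.fn x - (g.raise l).fn x| ≤ ∑ j ∈ Finset.range l, B j := by
  refine ((h.window g.a g.b).abs_treeFn_sub_le g.adm (le_max_left g.lo l)).trans
    (Finset.sum_le_sum_of_subset_of_nonneg (fun j hj => ?_) fun j _ _ => h.nonneg j)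
  rw [Finset.mem_sdiff] at hj
  rw [Finset.mem_range]
  by_contra hl
  exact hj.2 (mem_levels_of_le hj.1 (max_le (le_of_mem_levels hj.1) (not_lt.1 hl)))

theorem exists_high_level (x : FinSeq) {δ : ℝ} (hδ : 0 < δ) :
    ∃ (B : ℕ → ℝ) (l : ℕ), LevelBound x B ∧
      ∀ s : Finset ℕ, (∀ j ∈ s, l ≤ j) → ∑ j ∈ s, B j ≤ δ := by
  obtain ⟨s₀, hs₀⟩ := summable_iff_vanishing_norm.1
    (summable_wt.mul_right (∑ i ∈ x.support, |x i|)) δ hδ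
  refine ⟨_, s₀.sup id + 1, LevelBound.of_sum_abs x, fun s hs => ?_⟩
  refine (le_abs_self _).trans (hs₀ s (Finset.disjoint_left.2 fun j hj hj' => ?_)).le
  have h1 : j ≤ s₀.sup id := Finset.le_sup (f := id) hj'
  have h2 := hs j hj
  omega

/-- From finitely many arrays of numbers in `[-1, 1]` one can extract a subarray which is almost
constant below the diagonal. -/
theorem exists_subarray_near_const {ι : Type*} [Finite ι] (v : ℕ → ι → ℕ → ℝ)
    (hv : ∀ l i m, |v l i m| ≤ 1) {δ : ℝ} (hδ : 0 < δ) :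
    ∃ (k : ℕ → ℕ) (a : ι → ℝ), (∀ i, |a i| ≤ 1) ∧ StrictMono k ∧
      ∀ j m, m < j → ∀ i, |v (k j) i (k m) - a i| ≤ 2 * δ := by
  choose c hc hcl using fun i m => exists_tendsto_hyperfilter fun l => hv l i m
  choose a ha hal using fun i => exists_tendsto_hyperfilter (hc i)
  have hnear : ∀ {w : ℕ → ℝ} {t : ℝ}, Tendsto w (hyperfilter ℕ) (𝓝 t) →
      ∀ᶠ m in (hyperfilter ℕ : Filter ℕ), |w m - t| ≤ δ := by
    intro w t h
    filter_upwards [h (Metric.closedBall_mem_nhds t hδ)] with m hm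
    simpa [Real.dist_eq] using hm
  obtain ⟨k, hk, hr⟩ := exists_seq_of_forall_finset_exists (fun m => ∀ i, |c i m - a i| ≤ δ)
    (fun m l => m < l ∧ ∀ i, |v l i m - c i m| ≤ δ) (by
      intro s _
      have h1 : ∀ᶠ l in (hyperfilter ℕ : Filter ℕ), (∀ i, |c i l - a i| ≤ δ) ∧
          ∀ m ∈ s, m < l ∧ ∀ i, |v l i m - c i m| ≤ δ := by
        refine (eventually_all.2 fun i => hnear (hal i)).and
          ((Filter.eventually_all_finset s).2 fun m _ => ?_)
        exact Filter.Eventually.and (Nat.hyperfilter_le_atTop (eventually_gt_atTop m))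
          (eventually_all.2 fun i => hnear (hcl i m))
      exact h1.exists)
  refine ⟨k, a, ha, fun m j hmj => (hr m j hmj).1, fun j m hmj i => ?_⟩
  have h1 := (hr m j hmj).2 i
  have h2 := hk m i
  rw [show v (k j) i (k m) - a i = (v (k j) i (k m) - c i (k m)) + (c i (k m) - a i) by ring]
  refine (abs_add_le _ _).trans ?_
  linarith

/-- An alternating sum of numbers in `[-1, 1]` is small if, apart from one exceptional index, the
numbers are almost constant before it and almost zero after it. -/
theorem abs_alternating_sum_le {t : ℕ → ℝ} {n r e : ℕ} {a κ : ℝ} (hκ : 0 ≤ κ) (hr : r ≤ n)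
    (ht : ∀ j, |t j| ≤ 1) (ha : |a| ≤ 1) (h1 : ∀ j < e, |t j - a| ≤ κ)
    (h2 : ∀ j, e < j → j < n → |t j| ≤ κ) :
    |∑ j ∈ Finset.range r, (-1) ^ j * t j| ≤ 2 + n * κ := by
  set w : ℕ → ℝ := fun j => if j < e then a else 0 with hw
  have hsplit : ∑ j ∈ Finset.range r, (-1) ^ j * t j =
      ∑ j ∈ Finset.range r, (-1) ^ j * w j + ∑ j ∈ Finset.range r, (-1) ^ j * (t j - w j) := by
    rw [← Finset.sum_add_distrib]
    exact Finset.sum_congr rfl fun j _ => by ring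
  have hA : |∑ j ∈ Finset.range r, (-1) ^ j * w j| ≤ 1 := by
    have h3 : ∑ j ∈ Finset.range r, (-1) ^ j * w j =
        (∑ j ∈ Finset.range (min r e), (-1 : ℝ) ^ j) * a := by
      rw [Finset.sum_mul]
      have : Finset.range (min r e) = (Finset.range r).filter (· < e) := by
        ext j; simp
      rw [this, Finset.sum_filter]
      refine Finset.sum_congr rfl fun j _ => ?_
      rw [hw]; simp only; split_ifs <;> simp
    rw [h3, neg_one_geom_sum]
    split_ifs <;> simp [ha]
  have hB : |∑ j ∈ Finset.range r, (-1) ^ j * (t j - w j)| ≤ 1 + n * κ := by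
    have h3 : ∀ j ∈ Finset.range r, |(-1) ^ j * (t j - w j)| ≤ κ + if j = e then 1 else 0 := by
      intro j hj
      have hjr := Finset.mem_range.1 hj
      rw [abs_mul, abs_neg_one_pow, one_mul, hw]
      simp only
      rcases lt_trichotomy j e with h | h | h
      · rw [if_pos h, if_neg h.ne, add_zero]; exact h1 j h
      · rw [if_neg (by omega), if_pos h, sub_zero]; linarith [ht j]
      · rw [if_neg (by omega), if_neg h.ne', sub_zero, add_zero]; exact h2 j h (by omega)
    refine (Finset.abs_sum_le_sum_abs _ _).trans ((Finset.sum_le_sum h3).trans ?_)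
    rw [Finset.sum_add_distrib, Finset.sum_const, Finset.card_range, nsmul_eq_mul,
      Finset.sum_ite_eq']
    have h4 : (r : ℝ) * κ ≤ n * κ := mul_le_mul_of_nonneg_right (by exact_mod_cast hr) hκ
    split_ifs <;> linarith
  rw [hsplit]
  refine (abs_add_le _ _).trans ?_
  linarith

/-- Restricting an alternating sum of blocks to an initial interval costs at most one block. -/
theorem abs_window_alternating_sum_le {y : ℕ → FinSeq} {lo hi : ℕ → ℕ}
    (hy : IsBlockSeq y lo hi) (φ : FinSeq →ₗ[ℝ] ℝ) (hφ : ∀ j b, |φ (window 0 b (y j))| ≤ 1)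
    {n : ℕ} {T : ℝ} (hT : ∀ r ≤ n, |∑ j ∈ Finset.range r, (-1) ^ j * φ (y j)| ≤ T) (b r : ℕ)
    (hr : r ≤ n) : |φ (window 0 b (∑ j ∈ Finset.range r, (-1 : ℝ) ^ j • y j))| ≤ T + 1 := by
  have hT0 : 0 ≤ T := (abs_nonneg _).trans (hT 0 (Nat.zero_le _))
  induction r with
  | zero => simp; linarith
  | succ r ih =>
    rw [Finset.sum_range_succ, map_add, map_add]
    by_cases hb : b ≤ lo r
    · rw [map_smul, (hy.1 r).window_eq_zero (Or.inl hb), smul_zero, map_zero, add_zero]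
      exact ih (Nat.le_of_succ_le hr)
    · have h1 : window 0 b (∑ j ∈ Finset.range r, (-1 : ℝ) ^ j • y j) =
          ∑ j ∈ Finset.range r, (-1 : ℝ) ^ j • y j := by
        rw [map_sum]
        refine Finset.sum_congr rfl fun j hj => ?_
        rw [map_smul, (hy.1 j).window_eq (Nat.zero_le _)
          ((hy.2 j r (Finset.mem_range.1 hj)).trans (not_le.1 hb).le)]
      rw [h1, map_sum]
      simp only [map_smul, smul_eq_mul]
      refine (abs_add_le _ _).trans (add_le_add (hT r (Nat.le_of_succ_le hr)) ?_)
      rw [abs_mul, abs_neg_one_pow, one_mul]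
      exact hφ r b

namespace CoefClass

variable (K : CoefClass) {V : Submodule ℝ FinSeq}

theorem exists_normalized_far (hV : ¬ FiniteDimensional ℝ V) (N : ℕ) :
    ∃ x ∈ V, ∃ b, N ≤ b ∧ Within N b x ∧ K.normingSet.nm x = 1 := by
  obtain ⟨x, hx0, hx⟩ := exists_ne_zero_of_not_finiteDimensional hV
    (LinearMap.pi fun n : Fin N => (Finsupp.lapply n.1 : FinSeq →ₗ[ℝ] ℝ) ∘ₗ V.subtype)
  obtain ⟨b, hNb, hb⟩ := exists_within (a := N) (x := x.1) fun i hi => congrFun hx ⟨i, hi⟩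
  have hpos : 0 < K.normingSet.nm x.1 := NormingSet.nm_pos fun h => hx0 (Subtype.ext h)
  refine ⟨(K.normingSet.nm x.1)⁻¹ • x.1, V.smul_mem _ x.2, b, hNb, hb.smul _, ?_⟩
  rw [NormingSet.nm_smul, abs_of_pos (inv_pos.2 hpos), inv_mul_cancel₀ hpos.ne']

/-- Normalized vectors far out in an infinite dimensional subspace can have arbitrarily small
coordinates: otherwise a single node of high level would see a long sum of blocks with large
coordinates, while the coordinates of the sum remain bounded. -/
theorem exists_small_coords (hV : ¬ FiniteDimensional ℝ V) (N : ℕ) {η : ℝ} (hη : 0 < η) :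
    ∃ x ∈ V, ∃ b, N ≤ b ∧ Within N b x ∧ K.normingSet.nm x = 1 ∧ ∀ i, |x i| ≤ η := by
  by_contra! H
  obtain ⟨f, hf, hr⟩ := exists_seq_of_forall_finset_exists
    (α := FinSeq × ℕ × ℕ × ℕ)
    (fun d => d.1 ∈ V ∧ N ≤ d.2.1 ∧ Within d.2.1 d.2.2.1 d.1 ∧ K.normingSet.nm d.1 = 1 ∧
      η < d.1 d.2.2.2)
    (fun d d' => d.2.2.1 ≤ d'.2.1) (by
      intro s hs
      set N' := max N (s.sup fun d => d.2.2.1) with hN'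
      obtain ⟨x, hxV, b, hb, hxb, hx1⟩ := K.exists_normalized_far hV N'
      obtain ⟨i, hi⟩ := H x hxV b ((le_max_left _ _).trans hb)
        (hxb.mono (le_max_left _ _) le_rfl) hx1
      have hs' : ∀ d ∈ s, d.2.2.1 ≤ N' := fun d hd =>
        (Finset.le_sup (f := fun d : FinSeq × ℕ × ℕ × ℕ => d.2.2.1) hd).trans (le_max_right _ _)
      rcases lt_abs.1 hi with h | h
      · exact ⟨(x, N', b, i), ⟨hxV, le_max_left _ _, hxb, hx1, h⟩, hs'⟩
      · refine ⟨((-1 : ℝ) • x, N', b, i), ⟨V.smul_mem _ hxV, le_max_left _ _, hxb.smul _, ?_, ?_⟩,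
          hs'⟩
        · rw [NormingSet.nm_smul, hx1]; simp
        · simpa using h)
  have hblock : IsBlockSeq (fun k => (f k).1) (fun k => (f k).2.1) fun k => (f k).2.2.1 :=
    ⟨fun k => (hf k).2.2.1, hr⟩
  have hne : ∀ k, (f k).1 (f k).2.2.2 ≠ 0 := fun k => (hη.trans (hf k).2.2.2.2).ne'
  have hin : ∀ k, (f k).2.1 ≤ (f k).2.2.2 ∧ (f k).2.2.2 < (f k).2.2.1 := fun k =>
    not_not.1 fun h => hne k ((hf k).2.2.1 _ h)
  have hinj : Function.Injective fun k => (f k).2.2.2 := by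
    intro k l hkl
    simp only at hkl
    have h1 := hin k
    have h2 := hin l
    rcases lt_trichotomy k l with h | h | h
    · have := hr k l h; omega
    · exact h
    · have := hr l k h; omega
  obtain ⟨m, hm⟩ := pow_unbounded_of_one_lt (1 / η ^ 2) (by norm_num : (1 : ℝ) < 8)
  set L : List (Finset ℕ) := List.replicate m ∅ with hL
  have hadm : Admissible L := by
    rw [hL]
    clear hL L hm
    induction m with
    | zero => trivial
    | succ m ih => exact ⟨by simp, ih⟩
  set j := code L with hj
  have hmj : m ≤ j := by simpa [hL] using length_le_code L
  set I := (Finset.range (sz j)).image fun k => (f k).2.2.2 with hI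
  have hIc : I.card ≤ sz j := Finset.card_image_le.trans (Finset.card_range _).le
  set u := ∑ k ∈ Finset.range (sz j), (1 : ℝ) • (f k).1 with hu
  have huV : u ∈ V := V.sum_mem fun k _ => V.smul_mem _ (hf k).1
  have hnode : treeFn (I :: L) j u = wt j * ∑ i ∈ I, u i := by
    rw [treeFn, treeFn_eq_zero le_rfl, if_pos le_rfl, zero_add]
    simp [LinearMap.sum_apply, ← hj]
  have hsum : (sz j : ℝ) * η ≤ ∑ i ∈ I, u i := by
    rw [hI, Finset.sum_image (hinj.injOn)]
    have : ∀ k ∈ Finset.range (sz j), η ≤ u (f k).2.2.2 := by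
      intro k hk
      rw [hu, hblock.sum_apply (fun _ => 1) hk (hne k), one_mul]
      exact (hf k).2.2.2.2.le
    simpa using Finset.card_nsmul_le_sum _ _ _ this
  have hbig : 8 ^ (j + 1) * η ≤ K.normingSet.nm u := by
    have h1 := K.abs_treeFn_le_nm (L := I :: L) ⟨hIc, hadm⟩ j u
    rw [hnode] at h1
    refine le_trans ?_ ((le_abs_self _).trans h1)
    rw [← wt_mul_sz, mul_assoc]
    exact mul_le_mul_of_nonneg_left hsum (wt_pos j).le
  have hnpos : 0 < K.normingSet.nm u := lt_of_lt_of_le (by positivity) hbig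
  have hcoord : ∀ i, |u i| ≤ 1 := by
    intro i
    by_cases h : ∃ k ∈ Finset.range (sz j), (f k).1 i ≠ 0
    · obtain ⟨k, hk, hki⟩ := h
      rw [hu, hblock.sum_apply (fun _ => 1) hk hki, one_mul, ← (hf k).2.2.2.1]
      exact K.normingSet.abs_apply_le_nm _ _
    · push Not at h
      rw [hu, Finsupp.finsetSum_apply, Finset.sum_eq_zero fun k hk => by simp [h k hk]]
      simp
  obtain ⟨b, hNb, hb⟩ := exists_within (a := N) (x := u) fun i hi => by
    rw [hu, Finsupp.finsetSum_apply]
    refine Finset.sum_eq_zero fun k _ => ?_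
    have h1 := (hf k).2.2.1 i fun h' => by have := (hf k).2.1; omega
    simp [h1]
  obtain ⟨i, hi⟩ := H ((K.normingSet.nm u)⁻¹ • u) (V.smul_mem _ huV) b hNb (hb.smul _) (by
    rw [NormingSet.nm_smul, abs_of_pos (inv_pos.2 hnpos), inv_mul_cancel₀ hnpos.ne'])
  rw [Finsupp.smul_apply, smul_eq_mul, abs_mul, abs_of_pos (inv_pos.2 hnpos), inv_mul_eq_div,
    lt_div_iff₀ hnpos] at hi
  have h1 : η * (8 ^ (j + 1) * η) < 1 :=
    (mul_le_mul_of_nonneg_left hbig hη.le).trans_lt (hi.trans_le (hcoord i))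
  rw [div_lt_iff₀ (by positivity)] at hm
  have h2 : (8 : ℝ) ^ m ≤ 8 ^ (j + 1) := pow_le_pow_right₀ (by norm_num) (by omega)
  have h3 := mul_le_mul_of_nonneg_right h2 (sq_nonneg η)
  nlinarith

/-- The segments above level `l` which are `ε`-active on a normalized vector far out are controlled
by boundedly many node sequences: any admissible sequence which is active shares a level at least
`l` with one of them, hence, the levels being coded, all its nodes below that level. On vectors for
which the levels above `l` are negligible the two sequences therefore define almost the same
functional. -/
theorem exists_controlling_lists {R : ℕ} {ε δ : ℝ} (hR : 1 / ε ^ 2 < R) (hε : 0 < ε) {a b l : ℕ}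
    (ha : R ≤ a) {x : FinSeq} (hx : Within a b x) (hx1 : K.normingSet.nm x = 1)
    (hlow : ∀ g : Seg, |g.fn x - (g.raise l).fn x| ≤ δ) :
    ∃ p : Fin R → List (Finset ℕ), (∀ i, Admissible (p i)) ∧ ∀ L, Admissible L →
      ε + δ < |treeFn L 0 x| → ∃ i, ∀ z : FinSeq,
        (∀ g : Seg, l ≤ g.lo → |g.fn z| ≤ δ) → |treeFn L 0 z - treeFn (p i) 0 z| ≤ 2 * δ := by
  let Fam : (m : ℕ) → (Fin m → Seg) → Prop := fun m S =>
    Pairwise (fun i j => Disjoint (S i).lev (S j).lev) ∧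
      ∀ i, l ≤ (S i).lo ∧ a ≤ (S i).a ∧ ε ≤ |(S i).fn x|
  have hRpos : 0 < R := by
    rcases Nat.eq_zero_or_pos R with h | h
    · rw [h] at hR
      have : (0 : ℝ) < 1 / ε ^ 2 := by positivity
      norm_num at hR
      linarith [sq_nonneg ε, inv_pos.2 (pow_pos hε 2)]
    · exact h
  have hcard : ∀ m S, Fam m S → m < R := by
    intro m S hS
    by_contra! hm
    have : Nonempty (Fin R) := ⟨⟨0, hRpos⟩⟩
    have h1 := K.sum_abs_fn_le_sqrt_mul (g := fun i : Fin R => S (Fin.castLE hm i))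
      (fun i j hij => hS.1 fun h => hij (Fin.castLE_injective hm h))
      (fun i => by
        have := (hS.2 (Fin.castLE hm i)).2.1
        rw [Fintype.card_fin]; omega) x
    rw [hx1, mul_one, Fintype.card_fin] at h1
    have h2 : (R : ℝ) * ε ≤ √R := by
      refine le_trans ?_ h1
      have := Finset.card_nsmul_le_sum Finset.univ (fun i : Fin R => |(S (Fin.castLE hm i)).fn x|)
        ε fun i _ => (hS.2 _).2.2
      simpa using this
    have hRr : (0 : ℝ) < R := by exact_mod_cast hRpos
    have h3 : ((R : ℝ) * ε) ^ 2 ≤ R := by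
      calc ((R : ℝ) * ε) ^ 2 ≤ √R ^ 2 := pow_le_pow_left₀ (by positivity) h2 2
        _ = R := Real.sq_sqrt hRr.le
    rw [div_lt_iff₀ (by positivity)] at hR
    nlinarith
  obtain ⟨m, ⟨S, hS⟩, hmax⟩ : ∃ m, (∃ S, Fam m S) ∧ ∀ m' S', Fam m' S' → m' ≤ m := by
    have hne : {m | ∃ S, Fam m S}.Nonempty :=
      ⟨0, Fin.elim0, fun i => i.elim0, fun i => i.elim0⟩
    have hbdd : BddAbove {m | ∃ S, Fam m S} := ⟨R, fun m ⟨S, hS⟩ => (hcard m S hS).le⟩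
    exact ⟨_, Nat.sSup_mem hne hbdd, fun m' S' h => le_csSup hbdd ⟨S', h⟩⟩
  have hmR := hcard m S hS
  refine ⟨fun i => if h : i.1 < m then (S ⟨i, h⟩).list else [], fun i => ?_, fun L hL hact => ?_⟩
  · simp only
    split_ifs
    · exact (S _).adm
    · trivial
  · set g : Seg := ⟨L, hL, l, a, b⟩ with hg
    have hgact : ε ≤ |g.fn x| := by
      have h1 := hlow ⟨L, hL, 0, a, b⟩
      have h2 : (Seg.mk L hL 0 a b).raise l = g := by simp [Seg.raise, hg]
      have h3 : (Seg.mk L hL 0 a b).fn x = treeFn L 0 x := by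
        rw [Seg.fn, LinearMap.comp_apply, hx.window_eq le_rfl le_rfl]
      rw [h2, h3] at h1
      have := abs_sub_abs_le_abs_sub (treeFn L 0 x) (g.fn x)
      linarith
    obtain ⟨i, hi⟩ : ∃ i, ¬ Disjoint g.lev (S i).lev := by
      by_contra! hdis
      have hF : Fam (m + 1) (Fin.cons g S) := by
        refine ⟨?_, ?_⟩
        · intro i j hij
          refine Fin.cases ?_ (fun i => ?_) i (motive := fun i => i ≠ j → Disjoint
            (Fin.cons (α := fun _ => Seg) g S i).lev (Fin.cons (α := fun _ => Seg) g S j).lev) hij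
          · refine Fin.cases (fun h => absurd rfl h) (fun j _ => ?_) j
            simpa using hdis j
          · refine Fin.cases (fun _ => ?_) (fun j h => ?_) j
            · simpa using (hdis i).symm
            · simpa using hS.1 fun h' => h (by rw [h'])
        · intro i
          refine Fin.cases ?_ (fun i => ?_) i
          · simpa using ⟨le_rfl, le_rfl, hgact⟩
          · simpa using hS.2 i
      have := hmax _ _ hF
      omega
    obtain ⟨j, hj1, hj2⟩ := Finset.not_disjoint_iff.1 hi
    have hlj : l ≤ j := le_of_mem_levels hj1
    obtain ⟨I, Q, hQ, hcQ⟩ := exists_suffix_of_mem_levels hj1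
    obtain ⟨I', Q', hQ', hcQ'⟩ := exists_suffix_of_mem_levels hj2
    obtain rfl : Q = Q' := code_injective (hcQ.trans hcQ'.symm)
    refine ⟨⟨i, i.2.trans hmR⟩, fun z hz => ?_⟩
    simp only [dif_pos i.2, Fin.eta]
    rw [treeFn_eq_add_of_suffix (L := L) hQ, treeFn_eq_add_of_suffix hQ', hcQ]
    have hneg : ∀ P, Admissible P → |treeFn P j z| ≤ δ := by
      intro P hP
      obtain ⟨c, hc⟩ := exists_within_zero z
      rw [treeFn_eq_fn hP j hc]
      exact hz _ hlj
    have h1 := hneg L hL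
    have h2 := hneg (S i).list (S i).adm
    simp only [LinearMap.add_apply]
    rw [add_sub_add_left_eq_sub]
    refine (abs_sub _ _).trans ?_
    linarith

end CoefClass

/-- A vector supported in `[a, b)` which is essentially only seen by the levels in `[l, l')`, with
a segment using only these coordinates and these levels. -/
structure Piece where
  /-- The vector. -/
  x : FinSeq
  /-- The left end of the support. -/
  a : ℕ
  /-- The right end of the support. -/
  b : ℕ
  /-- The levels below `l` are negligible. -/
  l : ℕ
  /-- The levels from `l'` on are negligible. -/
  l' : ℕ
  /-- The segment attached to the vector. -/
  g : Seg

namespace CoefClass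

variable (K : CoefClass) {V : Submodule ℝ FinSeq}

/-- The properties required of a piece, with tolerance `δ` and lower bound `ε / 2` for the value of
the segment at the vector. -/
def IsGoodPiece (V : Submodule ℝ FinSeq) (N : ℕ) (ε δ : ℝ) (d : Piece) : Prop :=
  d.x ∈ V ∧ N ≤ d.a ∧ Within d.a d.b d.x ∧ K.normingSet.nm d.x = 1 ∧
    (∀ g : Seg, |g.fn d.x - (g.raise d.l).fn d.x| ≤ δ) ∧
    (∀ g : Seg, d.l' ≤ g.lo → |g.fn d.x| ≤ δ) ∧
    (∀ j ∈ d.g.lev, d.l ≤ j ∧ j < d.l') ∧ d.a ≤ d.g.a ∧ d.g.b ≤ d.b ∧ ε / 2 ≤ |d.g.fn d.x|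

variable {K}

theorem exists_goodPiece {N : ℕ} {ε δ : ℝ} (hδ : 0 < δ) (hδε : δ ≤ ε / 2)
    (hV : ¬ FiniteDimensional ℝ V)
    (H : ∀ u ∈ V, ∀ b, Within N b u → K.normingSet.nm u = 1 → ∃ g : Seg, ε < |g.fn u|)
    (a l : ℕ) (ha : N ≤ a) :
    ∃ d, K.IsGoodPiece V N ε δ d ∧ a ≤ d.a ∧ l ≤ d.l := by
  set S := ∑ j ∈ Finset.range l, wt j * sz j with hS
  have hS0 : 0 ≤ S := Finset.sum_nonneg fun j _ => mul_nonneg (wt_pos j).le (Nat.cast_nonneg _)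
  obtain ⟨x, hxV, b, hab, hxb, hx1, hxη⟩ := K.exists_small_coords hV a
    (η := δ / (S + 1)) (by positivity)
  have hlow : ∀ g : Seg, |g.fn x - (g.raise l).fn x| ≤ δ := by
    intro g
    refine (g.abs_fn_sub_raise_le l (LevelBound.of_abs_le hxη)).trans ?_
    rw [← Finset.sum_mul, ← hS, mul_div_assoc', div_le_iff₀ (by positivity)]
    nlinarith
  obtain ⟨g, hg⟩ := H x hxV b (hxb.mono ha le_rfl) hx1
  set g' := (g.raise l).restrict a b with hg'
  obtain ⟨B, l₁, hB, hl₁⟩ := exists_high_level x hδ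
  refine ⟨⟨x, a, b, l, max l₁ (g'.lev.sup id + 1), g'⟩,
    ⟨hxV, ha, hxb, hx1, hlow, ?_, ?_, le_max_right _ _, min_le_right _ _, ?_⟩, le_rfl, le_rfl⟩
  · intro h hh
    refine (h.abs_fn_le hB).trans (hl₁ _ fun j hj => ?_)
    exact (le_max_left _ _).trans (hh.trans (le_of_mem_levels hj))
  · intro j hj
    refine ⟨(le_max_right _ _).trans (le_of_mem_levels hj), lt_max_of_lt_right ?_⟩
    exact Nat.lt_succ_of_le (Finset.le_sup (f := id) hj)
  · simp only
    rw [hg', Seg.fn_restrict, LinearMap.comp_apply, hxb.window_eq le_rfl le_rfl]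
    have h1 := abs_sub_abs_le_abs_sub (g.fn x) ((g.raise l).fn x)
    have h2 := hlow g
    linarith

/-- In every infinite dimensional subspace of `c₀₀` there are normalized vectors far out on which
all segments are arbitrarily small. If this failed, the alternating sum of a suitable sequence of
`n` good pieces would have norm at least of order `√n`, while all segments would remain bounded
on it. -/
theorem exists_small_segments (K : CoefClass) (hV : ¬ FiniteDimensional ℝ V) (N₀ : ℕ) {ε : ℝ}
    (hε : 0 < ε) : ∃ u ∈ V, ∃ b, N₀ ≤ b ∧ Within N₀ b u ∧ K.normingSet.nm u = 1 ∧
      ∀ g : Seg, |g.fn u| ≤ ε := by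
  by_contra! H₀
  obtain ⟨n, hn⟩ := exists_nat_gt ((32 / ε ^ 2) ^ 2)
  have hnpos : (0 : ℝ) < n := lt_of_le_of_lt (by positivity) hn
  -- The activity threshold `ε'` and the tolerance `δ` satisfy `max (4 * δ) (ε' + δ) ≤ 1 / n`.
  set ε' : ℝ := 1 / (2 * n) with hε'
  have hε'pos : 0 < ε' := by positivity
  set δ : ℝ := min (1 / (4 * n)) (ε / 2) with hδ
  have hδpos : 0 < δ := by positivity
  have hδn : δ ≤ 1 / (4 * n) := min_le_left _ _
  have hκ1 : 4 * δ ≤ 1 / n := by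
    have : 4 * (1 / (4 * (n : ℝ))) = 1 / n := by field_simp
    linarith
  have hκ2 : ε' + δ ≤ 1 / n := by
    have h1 : 1 / (2 * (n : ℝ)) + 1 / (4 * n) = 3 / 4 * (1 / n) := by field_simp; norm_num
    have h2 : 0 < 1 / (n : ℝ) := by positivity
    rw [hε']; linarith
  obtain ⟨R, hR⟩ := exists_nat_gt (1 / ε' ^ 2)
  set N := max N₀ (max R n) with hN
  have H : ∀ u ∈ V, ∀ b, Within N b u → K.normingSet.nm u = 1 → ∃ g : Seg, ε < |g.fn u| :=
    fun u hu b hb h1 => H₀ u hu (max N₀ b) (le_max_left _ _)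
      (hb.mono (le_max_left _ _) (le_max_right _ _)) h1
  obtain ⟨f, hf, hr⟩ := exists_seq_of_forall_finset_exists (K.IsGoodPiece V N ε δ)
    (fun d d' => d.b ≤ d'.a ∧ d.l' ≤ d'.l) (by
      intro s _
      obtain ⟨d, hd, h1, h2⟩ := exists_goodPiece hδpos (min_le_right _ _) hV H
        (max N (s.sup Piece.b)) (s.sup Piece.l') (le_max_left _ _)
      exact ⟨d, hd, fun d' hd' => ⟨(Finset.le_sup hd').trans ((le_max_right _ _).trans h1),
        (Finset.le_sup hd').trans h2⟩⟩)
  choose hxV hNa hin hx1 hlow hhigh hlev hga hgb hgx using hf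
  choose p hpadm hp using fun l => K.exists_controlling_lists hR hε'pos
    (((le_max_left R n).trans (le_max_right N₀ _)).trans (hNa l)) (hin l) (hx1 l) (hlow l)
  obtain ⟨k, c, hc, hk, hkc⟩ := exists_subarray_near_const
    (fun l i m => treeFn (p l i) 0 (f m).x)
    (fun l i m => (K.abs_treeFn_le_nm (hpadm l i) 0 _).trans (hx1 m).le) hδpos
  set y : ℕ → FinSeq := fun j => (f (k j)).x with hy
  have hblock : IsBlockSeq y (fun j => (f (k j)).a) fun j => (f (k j)).b :=
    ⟨fun j => hin _, fun m j hmj => (hr _ _ (hk hmj)).1⟩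
  have hone : ∀ L, Admissible L → ∀ j, |treeFn L 0 (y j)| ≤ 1 := fun L hL j =>
    (K.abs_treeFn_le_nm hL 0 _).trans (hx1 _).le
  have halt : ∀ L, Admissible L → ∀ r ≤ n,
      |∑ j ∈ Finset.range r, (-1) ^ j * treeFn L 0 (y j)| ≤ 3 := by
    intro L hL r hrn
    have hκ : 2 + (n : ℝ) * (1 / n) = 3 := by field_simp; norm_num
    rw [← hκ]
    -- The exceptional index is the last one at which `L` is active.
    obtain ⟨e, a, ha, h1, h2⟩ : ∃ (e : ℕ) (a : ℝ), |a| ≤ 1 ∧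
        (∀ j < e, |treeFn L 0 (y j) - a| ≤ 1 / n) ∧
        ∀ j, e < j → j < n → |treeFn L 0 (y j)| ≤ 1 / n := by
      by_cases hact : ∃ j < n, ε' + δ < |treeFn L 0 (y j)|
      · classical
        set e := Nat.findGreatest (fun j => ε' + δ < |treeFn L 0 (y j)|) (n - 1) with he
        obtain ⟨j₀, hj₀, hj₀'⟩ := hact
        have hespec : ε' + δ < |treeFn L 0 (y e)| :=
          Nat.findGreatest_spec (P := fun j => ε' + δ < |treeFn L 0 (y j)|)
            (Nat.le_sub_one_of_lt hj₀) hj₀'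
        obtain ⟨i, hi⟩ := hp (k e) L hL hespec
        refine ⟨e, c i, hc i, fun j hj => ?_, fun j hej hjn => ?_⟩
        · have h3 := hi (y j) fun g hg => hhigh (k j) g ((hr _ _ (hk hj)).2.trans hg)
          have h4 := hkc e j hj i
          refine le_trans ?_ hκ1
          calc |treeFn L 0 (y j) - c i|
              = |(treeFn L 0 (y j) - treeFn (p (k e) i) 0 (y j)) +
                  (treeFn (p (k e) i) 0 (y j) - c i)| := by congr 1; ring
            _ ≤ 2 * δ + 2 * δ := (abs_add_le _ _).trans (add_le_add h3 h4)
            _ = 4 * δ := by ring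
        · have h3 : ¬ ε' + δ < |treeFn L 0 (y j)| :=
            Nat.findGreatest_is_greatest (P := fun j => ε' + δ < |treeFn L 0 (y j)|) hej
              (Nat.le_sub_one_of_lt hjn)
          exact (not_lt.1 h3).trans hκ2
      · push Not at hact
        exact ⟨0, 0, by simp, fun j hj => absurd hj (Nat.not_lt_zero _),
          fun j _ hj => (hact j hj).trans hκ2⟩
    exact abs_alternating_sum_le (by positivity) hrn (hone L hL) ha h1 h2
  set u := ∑ j ∈ Finset.range n, (-1 : ℝ) ^ j • y j with hu
  have hwin : ∀ L, Admissible L → ∀ b, |treeFn L 0 (window 0 b u)| ≤ 4 := by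
    intro L hL b
    have := abs_window_alternating_sum_le hblock (treeFn L 0) (fun j b =>
      (K.abs_treeFn_le_nm hL 0 _).trans ((NormingSet.nm_window_le _ _ _).trans (hx1 _).le))
      (halt L hL) b n le_rfl
    rw [← hu] at this
    linarith
  have hseg : ∀ g : Seg, |g.fn u| ≤ 16 := by
    intro g
    obtain ⟨L', hL', hLe⟩ := exists_treeFn_eq_sub g.adm g.lo
    have hwab : window g.a g.b u = window 0 (max g.a g.b) u - window 0 g.a u := by
      ext i
      rw [Finsupp.sub_apply]
      simp only [window_apply]
      by_cases h1 : g.a ≤ i <;> by_cases h2 : i < g.b <;> simp [h1, h2, not_lt.2, not_le.1]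
    rw [Seg.fn, LinearMap.comp_apply, hLe, hwab]
    simp only [LinearMap.sub_apply, map_sub]
    have h1 := _root_.abs_le.1 (hwin g.list g.adm (max g.a g.b))
    have h2 := _root_.abs_le.1 (hwin g.list g.adm g.a)
    have h3 := _root_.abs_le.1 (hwin L' hL' (max g.a g.b))
    have h4 := _root_.abs_le.1 (hwin L' hL' g.a)
    rw [_root_.abs_le]
    constructor <;> linarith [h1.1, h1.2, h2.1, h2.2, h3.1, h3.2, h4.1, h4.2]
  have huV : u ∈ V := V.sum_mem fun j _ => V.smul_mem _ (hxV _)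
  have hnN : 0 < n := by exact_mod_cast hnpos
  -- The segments of the pieces give the lower estimate.
  have hlower : √n * (ε / 2) ≤ K.normingSet.nm u := by
    have : Nonempty (Fin n) := ⟨⟨0, hnN⟩⟩
    have h1 := K.sum_abs_fn_le_sqrt_mul (g := fun j : Fin n => (f (k j)).g)
      (fun i j hij => by
        refine Finset.disjoint_left.2 ?_
        intro q hq1 hq2
        rcases lt_or_gt_of_ne (fun h => hij (Fin.ext h) : (i : ℕ) ≠ j) with h | h
        · have := (hr _ _ (hk h)).2
          have h5 := hlev _ _ hq1
          have h6 := hlev _ _ hq2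
          omega
        · have := (hr _ _ (hk h)).2
          have h5 := hlev _ _ hq1
          have h6 := hlev _ _ hq2
          omega)
      (fun i => by
        have h5 := hga (k i)
        have h6 := hNa (k i)
        have h7 : n ≤ N := (le_max_right R n).trans (le_max_right N₀ _)
        rw [Fintype.card_fin]; omega) u
    have h2 : ∀ j : Fin n, ε / 2 ≤ |((f (k j)).g).fn u| := by
      intro j
      have h3 : ((f (k j)).g).fn u = (-1) ^ (j : ℕ) * ((f (k j)).g).fn (y j) := by
        rw [hu, map_sum, Finset.sum_eq_single (j : ℕ)]
        · rw [map_smul, smul_eq_mul]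
        · intro i _ hij
          rw [map_smul, Seg.fn_eq_zero _ (hin (k i)), smul_zero]
          rcases lt_or_gt_of_ne hij with h | h
          · exact Or.inl ((hr _ _ (hk h)).1.trans (hga _))
          · exact Or.inr ((hgb _).trans (hr _ _ (hk h)).1)
        · intro h; exact absurd (Finset.mem_range.2 j.2) h
      rw [h3, abs_mul, abs_neg_one_pow, one_mul]
      exact hgx _
    have h4 := Finset.card_nsmul_le_sum Finset.univ (fun j : Fin n => |((f (k j)).g).fn u|) (ε / 2)
      fun j _ => h2 j
    rw [Finset.card_univ, Fintype.card_fin, nsmul_eq_mul] at h4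
    rw [Fintype.card_fin] at h1
    have h5 : √(n : ℝ) * (√n * (ε / 2)) ≤ √n * K.normingSet.nm u := by
      rw [← mul_assoc, Real.mul_self_sqrt hnpos.le]
      exact h4.trans h1
    exact le_of_mul_le_mul_left h5 (Real.sqrt_pos.2 hnpos)
  have hupos : 0 < K.normingSet.nm u :=
    lt_of_lt_of_le (mul_pos (Real.sqrt_pos.2 hnpos) (half_pos hε)) hlower
  obtain ⟨b, -, hb⟩ := exists_within (a := N) (x := u) fun i hi => by
    rw [hu, Finsupp.finsetSum_apply]
    refine Finset.sum_eq_zero fun j _ => ?_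
    have h1 := hin (k j) i fun h' => by have := hNa (k j); omega
    rw [Finsupp.smul_apply, hy]
    simp only [h1, smul_zero]
  obtain ⟨g, hg⟩ := H ((K.normingSet.nm u)⁻¹ • u) (V.smul_mem _ huV) b (hb.smul _) (by
    rw [NormingSet.nm_smul, abs_of_pos (inv_pos.2 hupos), inv_mul_cancel₀ hupos.ne'])
  rw [map_smul, smul_eq_mul, abs_mul, abs_of_pos (inv_pos.2 hupos), inv_mul_eq_div,
    lt_div_iff₀ hupos] at hg
  have h1 := hseg g
  have h2 : 32 / ε ^ 2 < √n := (Real.lt_sqrt (by positivity)).2 hn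
  rw [div_lt_iff₀ (by positivity)] at h2
  have h3 := mul_le_mul_of_nonneg_left hlower hε.le
  nlinarith

end CoefClass

/-! ### The space saturated by `c₀` -/

/-- A sum of normalized blocks has coordinates bounded by its coefficients. -/
theorem IsBlockSeq.abs_sum_apply_le {W : NormingSet} {z : ℕ → FinSeq} {lo hi : ℕ → ℕ}
    (h : IsBlockSeq z lo hi) (hz : ∀ k, W.nm (z k) = 1) {s : Finset ℕ} {c : ℕ → ℝ} {D : ℝ}
    (hc : ∀ k, |c k| ≤ D) (i : ℕ) : |(∑ k ∈ s, c k • z k) i| ≤ D := by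
  by_cases h' : ∃ k ∈ s, z k i ≠ 0
  · obtain ⟨k, hk, hki⟩ := h'
    rw [h.sum_apply c hk hki, abs_mul]
    have h1 := W.abs_apply_le_nm (z k) i
    rw [hz] at h1
    exact (mul_le_of_le_one_right (abs_nonneg _) h1).trans (hc k)
  · push Not at h'
    rw [Finsupp.finsetSum_apply, Finset.sum_eq_zero fun k hk => by simp [h' k hk], abs_zero]
    exact (abs_nonneg _).trans (hc 0)

namespace CoefClass

/-- The Schreier type class: coefficients bounded by `1`, for at most `N + 1` segments with
coordinates in `[N, ∞)`. -/
def cZero : CoefClass where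
  mem ι _ c N := (∀ i, |c i| ≤ 1) ∧ Fintype.card ι ≤ N + 1
  abs_le _ _ _ _ h := h.1
  flat ι _ c N hN h := by
    refine ⟨fun i => ?_, hN⟩
    have h1 : (1 : ℝ) ≤ Fintype.card ι := by
      exact_mod_cast Fintype.card_pos_iff.2 ⟨i⟩
    have h2 : c i ^ 2 ≤ 1 := by nlinarith [h i, sq_nonneg (c i)]
    exact (sq_le_one_iff_abs_le_one _).1 h2

/-- Every infinite dimensional subspace of `c₀₀` contains a block sequence equivalent to the unit
vectors of `c₀`: blocks on which all segments are small compared with the end of the support of the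
previous blocks. -/
theorem exists_cZero_blocks {V : Submodule ℝ FinSeq} (hV : ¬ FiniteDimensional ℝ V) :
    ∃ (z : ℕ → FinSeq) (lo hi : ℕ → ℕ), IsBlockSeq z lo hi ∧ (∀ k, z k ∈ V) ∧
      (∀ k, cZero.normingSet.nm (z k) = 1) ∧ ∀ (s : Finset ℕ) (c : ℕ → ℝ) (D : ℝ),
        (∀ k, |c k| ≤ D) → cZero.normingSet.nm (∑ k ∈ s, c k • z k) ≤ 2 * D := by
  obtain ⟨f, hf, hr⟩ := exists_seq_of_forall_finset_exists
    (α := FinSeq × ℕ × ℕ × ℝ)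
    (fun d => d.1 ∈ V ∧ Within d.2.1 d.2.2.1 d.1 ∧ cZero.normingSet.nm d.1 = 1 ∧
      0 < d.2.2.2 ∧ d.2.2.2 ≤ 1 / 2)
    (fun d d' => d.2.2.1 ≤ d'.2.1 ∧ d'.2.2.2 ≤ d.2.2.2 / 2 ∧
      ∀ g : Seg, d.2.2.1 * |g.fn d'.1| ≤ d'.2.2.2) (by
      intro s hs
      obtain ⟨r, hr0, hr1, hrs⟩ := exists_tolerance s (fun d => d.2.2.2)
        (fun d hd => (hs d hd).2.2.2.1) (by norm_num : (0 : ℝ) < 1 / 2)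
      set N := s.sup fun d => d.2.2.1 with hN
      obtain ⟨x, hxV, b, -, hb, hx1, hx⟩ := cZero.exists_small_segments hV N
        (ε := r / (N + 1)) (by positivity)
      refine ⟨(x, N, b, r), ⟨hxV, hb, hx1, hr0, hr1⟩, fun d hd => ?_⟩
      have hdN : d.2.2.1 ≤ N := Finset.le_sup (f := fun d : FinSeq × ℕ × ℕ × ℝ => d.2.2.1) hd
      refine ⟨hdN, hrs d hd, fun g => ?_⟩
      have h1 := hx g
      rw [le_div_iff₀ (by positivity)] at h1
      have h2 : (d.2.2.1 : ℝ) ≤ N := by exact_mod_cast hdN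
      have h3 := mul_le_mul_of_nonneg_right h2 (abs_nonneg (g.fn x))
      simp only
      linarith [abs_nonneg (g.fn x)])
  have hblock : IsBlockSeq (fun k => (f k).1) (fun k => (f k).2.1) fun k => (f k).2.2.1 :=
    ⟨fun k => (hf k).2.1, fun m n hmn => (hr m n hmn).1⟩
  refine ⟨_, _, _, hblock, fun k => (hf k).1, fun k => (hf k).2.2.1, fun s c D hD => ?_⟩
  have hD0 : 0 ≤ D := (abs_nonneg _).trans (hD 0)
  refine NormingSet.nm_le (by linarith) ?_
  rintro w (⟨n, rfl⟩ | hw)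
  · have := hblock.abs_sum_apply_le (W := cZero.normingSet) (fun k => (hf k).2.2.1) (s := s) hD n
    rw [Finsupp.lapply_apply]; linarith
  · have hwle : ∀ k, |w (f k).1| ≤ 1 := fun k =>
      (NormingSet.abs_le_nm hw.mem _).trans (hf k).2.2.1.le
    obtain ⟨ι, _, g, a, N, ha, hN, hd, rfl⟩ := hw
    -- Blocks ending before `N` are not seen, the next one contributes at most `1`, and on all
    -- later ones at most `N + 1` segments act, each of which is small.
    have key : ∃ e, ∀ k, k ≠ e → |(∑ i, a i • (g i).fn) (f k).1| ≤ (f k).2.2.2 := by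
      by_cases he : ∃ k, N < (f k).2.2.1
      · classical
        refine ⟨Nat.find he, fun k hk => ?_⟩
        rcases lt_or_gt_of_ne hk with h | h
        · have h1 : (∑ i, a i • (g i).fn) (f k).1 = 0 := by
            rw [LinearMap.sum_apply]
            refine Finset.sum_eq_zero fun i _ => ?_
            rw [LinearMap.smul_apply, Seg.fn_eq_zero _ (hf k).2.1, smul_zero]
            exact Or.inl ((not_lt.1 (Nat.find_min he h)).trans (hN i))
          rw [h1, abs_zero]; exact (hf k).2.2.2.1.le
        · have h1 := (hr _ _ h).2.2
          have h2 : (Fintype.card ι : ℝ) ≤ (f (Nat.find he)).2.2.1 := by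
            exact_mod_cast ha.2.trans (Nat.find_spec he)
          rw [LinearMap.sum_apply]
          by_cases hι : Nonempty ι
          · obtain ⟨i₀, -, hi₀⟩ := Finset.exists_max_image Finset.univ
              (fun i => |(g i).fn (f k).1|) Finset.univ_nonempty
            calc |∑ i, (a i • (g i).fn) (f k).1| ≤ ∑ i : ι, |(g i₀).fn (f k).1| := by
                  refine (Finset.abs_sum_le_sum_abs _ _).trans (Finset.sum_le_sum fun i hi => ?_)
                  rw [LinearMap.smul_apply, smul_eq_mul, abs_mul]
                  exact (mul_le_of_le_one_left (abs_nonneg _) (ha.1 i)).trans (hi₀ i hi)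
              _ = Fintype.card ι * |(g i₀).fn (f k).1| := by
                  rw [Finset.sum_const, Finset.card_univ, nsmul_eq_mul]
              _ ≤ _ := (mul_le_mul_of_nonneg_right h2 (abs_nonneg _)).trans (h1 _)
          · rw [not_nonempty_iff] at hι
            simpa using (hf k).2.2.2.1.le
      · push Not at he
        refine ⟨0, fun k _ => ?_⟩
        have h1 : (∑ i, a i • (g i).fn) (f k).1 = 0 := by
          rw [LinearMap.sum_apply]
          refine Finset.sum_eq_zero fun i _ => ?_
          rw [LinearMap.smul_apply, Seg.fn_eq_zero _ (hf k).2.1, smul_zero]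
          exact Or.inl ((he k).trans (hN i))
        rw [h1, abs_zero]; exact (hf k).2.2.2.1.le
    obtain ⟨e, he⟩ := key
    set w : FinSeq →ₗ[ℝ] ℝ := ∑ i, a i • (g i).fn with hw
    have hρ : ∀ k, |w (f k).1| ≤ (f k).2.2.2 / 2 * 2 + if k = e then 1 else 0 := by
      intro k
      by_cases h : k = e
      · rw [if_pos h]; linarith [hwle k, (hf k).2.2.2.1]
      · rw [if_neg h]; linarith [he k h]
    have hsum := sum_le_of_halving (ρ := fun k => (f k).2.2.2 / 2) (c := 1 / 4)
      (fun k => by linarith [(hf k).2.2.2.2]) (fun k => by linarith [(hf k).2.2.2.1])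
      (fun m n hmn => by linarith [(hr m n hmn).2.1]) s
    rw [map_sum]
    calc |∑ k ∈ s, w (c k • (f k).1)|
        ≤ ∑ k ∈ s, D * ((f k).2.2.2 / 2 * 2 + if k = e then 1 else 0) := by
          refine (Finset.abs_sum_le_sum_abs _ _).trans (Finset.sum_le_sum fun k _ => ?_)
          rw [map_smul, smul_eq_mul, abs_mul]
          exact mul_le_mul (hD k) (hρ k) (abs_nonneg _) hD0
      _ = D * ((∑ k ∈ s, (f k).2.2.2 / 2) * 2 + if e ∈ s then 1 else 0) := by
          rw [← Finset.mul_sum, Finset.sum_add_distrib, Finset.sum_mul, Finset.sum_ite_eq']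
      _ ≤ D * 2 := by
          refine mul_le_mul_of_nonneg_left ?_ hD0
          split_ifs <;> linarith
      _ = 2 * D := mul_comm _ _

end CoefClass

/-- The inclusion of `c₀₀` in `c₀`. -/
noncomputable def toSeqCZero : FinSeq →ₗ[ℝ] SeqCZero where
  toFun a :=
    { toFun := a
      continuous_toFun := continuous_of_discreteTopology
      zero_at_infty' := by
        refine tendsto_nhds_of_eventually_eq ?_
        rw [cocompact_eq_cofinite, eventually_cofinite]
        exact a.support.finite_toSet.subset fun i hi => Finsupp.mem_support_iff.2 hi }
  map_add' _ _ := rfl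
  map_smul' _ _ := rfl

theorem toSeqCZero_apply (a : FinSeq) (i : ℕ) : toSeqCZero a i = a i := rfl

theorem SeqCZero.abs_apply_le (f : SeqCZero) (i : ℕ) : |f i| ≤ ‖f‖ := by
  rw [← ZeroAtInftyContinuousMap.norm_toBCF_eq_norm]
  exact f.toBCF.norm_coe_le_norm i

theorem SeqCZero.norm_le {f : SeqCZero} {C : ℝ} (hC : 0 ≤ C) (h : ∀ i, |f i| ≤ C) : ‖f‖ ≤ C := by
  rw [← ZeroAtInftyContinuousMap.norm_toBCF_eq_norm]
  exact (BoundedContinuousFunction.norm_le hC).2 h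

theorem denseRange_toSeqCZero : DenseRange toSeqCZero := by
  rw [Metric.denseRange_iff]
  intro f r hr
  have h1 : ∀ᶠ i in cofinite, |f i| < r / 2 := by
    have h2 := f.zero_at_infty'
    rw [cocompact_eq_cofinite] at h2
    filter_upwards [h2 (Metric.ball_mem_nhds 0 (half_pos hr))] with i hi
    simpa [Real.dist_eq] using hi
  rw [eventually_cofinite] at h1
  refine ⟨Finsupp.onFinset h1.toFinset (fun i => if |f i| < r / 2 then 0 else f i) fun i hi => ?_,
    ?_⟩
  · rw [Set.Finite.mem_toFinset]
    intro h
    exact hi (if_pos h)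
  · rw [dist_eq_norm]
    refine lt_of_le_of_lt (SeqCZero.norm_le (half_pos hr).le fun i => ?_) (half_lt_self hr)
    rw [ZeroAtInftyContinuousMap.sub_apply, toSeqCZero_apply, Finsupp.onFinset_apply]
    split_ifs with h
    · simpa using h.le
    · simpa using (half_pos hr).le

theorem CoefClass.isSaturatedBy_cZero :
    IsSaturatedBy SeqCZero CoefClass.cZero.normingSet.Space := by
  refine NormingSet.isSaturatedBy_of_forall_submodule _ toSeqCZero denseRange_toSeqCZero
    fun V hV => ?_
  obtain ⟨z, lo, hi, hblock, hzV, hz1, hup⟩ := CoefClass.exists_cZero_blocks hV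
  refine ⟨Finsupp.linearCombination ℝ z, 1, 2, one_pos, fun a => ?_, fun a => ?_, fun a => ?_⟩
  · rw [Finsupp.linearCombination_apply, Finsupp.sum]
    exact V.sum_mem fun k _ => V.smul_mem _ (hzV k)
  · rw [one_mul]
    exact SeqCZero.norm_le (NormingSet.nm_nonneg _ _) fun k =>
      NormingSet.abs_le_nm_linearCombination hblock hz1 a k
  · rw [Finsupp.linearCombination_apply, Finsupp.sum]
    exact hup _ _ _ fun k => SeqCZero.abs_apply_le (toSeqCZero a) k

/-! ### The space saturated by `ℓ₂` -/

/-- Among segments with pairwise disjoint levels at most `l` have a level below `l`. -/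
theorem card_le_of_lev_lt {ι : Type*} {g : ι → Seg}
    (hd : Pairwise (fun i j => Disjoint (g i).lev (g j).lev)) {l : ℕ} {s : Finset ι}
    (hs : ∀ i ∈ s, ∃ j ∈ (g i).lev, j < l) : s.card ≤ l := by
  choose! j hj hjl using hs
  rw [← Finset.card_range l]
  refine Finset.card_le_card_of_injOn j (fun i hi => Finset.mem_coe.2
    (Finset.mem_range.2 (hjl i hi))) fun i hi i' hi' h => ?_
  by_contra hne
  exact Finset.disjoint_left.1 (hd hne) (hj i hi) (h ▸ hj i' hi')

namespace CoefClass

/-- The class of coefficients in the unit ball of `ℓ₂`. -/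
def lTwo : CoefClass where
  mem _ _ c _ := ∑ i, c i ^ 2 ≤ 1
  abs_le _ _ c _ h i := (sq_le_one_iff_abs_le_one _).1
    ((Finset.single_le_sum (f := fun i => c i ^ 2) (fun _ _ => sq_nonneg _)
      (Finset.mem_univ i)).trans h)
  flat ι _ c N _ h := by
    rcases isEmpty_or_nonempty ι with hι | hι
    · simp
    · have hpos : (0 : ℝ) < Fintype.card ι := by exact_mod_cast Fintype.card_pos
      calc ∑ i, c i ^ 2 ≤ ∑ _i : ι, (1 / (Fintype.card ι : ℝ)) :=
            Finset.sum_le_sum fun i _ => by rw [le_div_iff₀ hpos]; exact h i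
        _ = 1 := by
            rw [Finset.sum_const, Finset.card_univ, nsmul_eq_mul]; field_simp

/-- The functional `w` is a combination of segments with coefficients in the unit ball of `ℓ₂`,
with coordinates in `[a, b)` and levels in `[l, l')`. -/
def IsLocalComb (a b l l' : ℕ) (w : FinSeq →ₗ[ℝ] ℝ) : Prop :=
  ∃ (ι : Type) (_ : Fintype ι) (g : ι → Seg) (c : ι → ℝ), ∑ i, c i ^ 2 ≤ 1 ∧
    (∀ i, a ≤ (g i).a ∧ (g i).b ≤ b) ∧ Pairwise (fun i j => Disjoint (g i).lev (g j).lev) ∧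
    (∀ i, ∀ j ∈ (g i).lev, l ≤ j ∧ j < l') ∧ w = ∑ i, c i • (g i).fn

theorem IsLocalComb.apply_eq_zero {a b l l' : ℕ} {w : FinSeq →ₗ[ℝ] ℝ} (h : IsLocalComb a b l l' w)
    {a' b' : ℕ} {x : FinSeq} (hx : Within a' b' x) (hab : b' ≤ a ∨ b ≤ a') : w x = 0 := by
  obtain ⟨ι, _, g, c, -, hg, -, -, rfl⟩ := h
  rw [LinearMap.sum_apply]
  refine Finset.sum_eq_zero fun i _ => ?_
  rw [LinearMap.smul_apply, Seg.fn_eq_zero _ hx, smul_zero]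
  exact hab.imp (fun h => h.trans (hg i).1) fun h => (hg i).2.trans h

/-- Combinations of segments with successive sets of levels may be combined again with
coefficients in the unit ball of `ℓ₂`. -/
theorem isComb_sum_of_isLocalComb {a b l l' : ℕ → ℕ} {w : ℕ → FinSeq →ₗ[ℝ] ℝ}
    (hw : ∀ k, IsLocalComb (a k) (b k) (l k) (l' k) (w k)) (hl : ∀ m n, m < n → l' m ≤ l n)
    (s : Finset ℕ) (γ : ℕ → ℝ) (hγ : ∑ k ∈ s, γ k ^ 2 ≤ 1) :
    lTwo.IsComb (∑ k ∈ s, γ k • w k) := by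
  choose ι hι g c hc hg hd hlev hwe using hw
  refine ⟨(k : s) × ι k, inferInstance, fun i => g i.1 i.2, fun i => γ i.1 * c i.1 i.2, 0, ?_,
    fun _ => Nat.zero_le _, ?_, ?_⟩
  · change ∑ i : (k : s) × ι k, (γ i.1 * c i.1 i.2) ^ 2 ≤ 1
    rw [Fintype.sum_sigma]
    refine le_trans ?_ hγ
    rw [← Finset.sum_coe_sort s]
    refine Finset.sum_le_sum fun k _ => ?_
    simp only [mul_pow]
    rw [← Finset.mul_sum]
    exact mul_le_of_le_one_right (sq_nonneg _) (hc k)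
  · rintro ⟨k, i⟩ ⟨k', i'⟩ hne
    by_cases h : k = k'
    · subst h
      exact hd k fun h : i = i' => hne (by rw [h])
    · refine Finset.disjoint_left.2 fun j hj hj' => ?_
      have h1 := hlev _ _ j hj
      have h2 := hlev _ _ j hj'
      rcases lt_or_gt_of_ne (fun h' => h (Subtype.ext h') : k.1 ≠ k'.1) with h' | h'
      · have := hl _ _ h'; simp only at h1 h2; omega
      · have := hl _ _ h'; simp only at h1 h2; omega
  · rw [Fintype.sum_sigma, ← Finset.sum_coe_sort s]
    refine Finset.sum_congr rfl fun k _ => ?_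
    conv_lhs => rw [hwe k, Finset.smul_sum]
    simp only [smul_smul]

/-- A part of a combination of segments is bounded by the `ℓ₂` norm of its coefficients. -/
theorem abs_sum_smul_fn_le {ι : Type} [Fintype ι] {g : ι → Seg}
    (hd : Pairwise (fun i j => Disjoint (g i).lev (g j).lev)) (c : ι → ℝ) (E : Finset ι)
    (x : FinSeq) :
    |∑ i ∈ E, c i * (g i).fn x| ≤ √(∑ i ∈ E, c i ^ 2) * lTwo.normingSet.nm x := by
  classical
  set γ := √(∑ i ∈ E, c i ^ 2) with hγ
  have hnn : 0 ≤ ∑ i ∈ E, c i ^ 2 := Finset.sum_nonneg fun _ _ => sq_nonneg _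
  have hγ2 : γ ^ 2 = ∑ i ∈ E, c i ^ 2 := Real.sq_sqrt hnn
  rcases (Real.sqrt_nonneg (∑ i ∈ E, c i ^ 2)).eq_or_lt with h0 | hpos
  · rw [← hγ] at h0
    rw [← h0, zero_mul]
    have h1 : ∑ i ∈ E, c i ^ 2 = 0 := by rw [← hγ2, ← h0]; norm_num
    rw [Finset.sum_eq_zero_iff_of_nonneg fun _ _ => sq_nonneg _] at h1
    rw [Finset.sum_eq_zero fun i hi => by rw [pow_eq_zero_iff two_ne_zero |>.1 (h1 i hi), zero_mul]]
    simp
  · rw [← hγ] at hpos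
    have hmem : lTwo.IsComb (∑ i, (if i ∈ E then c i / γ else 0) • (g i).fn) := by
      refine ⟨ι, _, g, _, 0, ?_, fun _ => Nat.zero_le _, hd, rfl⟩
      change ∑ i, (if i ∈ E then c i / γ else 0) ^ 2 ≤ 1
      have h1 : ∀ i, (if i ∈ E then c i / γ else 0) ^ 2 = if i ∈ E then c i ^ 2 / γ ^ 2 else 0 := by
        intro i; split_ifs <;> simp [div_pow]
      simp only [h1]
      rw [Finset.sum_ite_mem, Finset.univ_inter, ← Finset.sum_div, ← hγ2,
        div_self (pow_pos hpos 2).ne']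
    have h2 := NormingSet.abs_le_nm hmem.mem x
    have h3 : (∑ i, (if i ∈ E then c i / γ else 0) • (g i).fn) x =
        (∑ i ∈ E, c i * (g i).fn x) / γ := by
      rw [LinearMap.sum_apply, Finset.sum_div]
      simp only [LinearMap.smul_apply, smul_eq_mul, ite_mul, zero_mul]
      rw [Finset.sum_ite_mem, Finset.univ_inter]
      exact Finset.sum_congr rfl fun i _ => by ring
    rw [h3, abs_div, abs_of_pos hpos, div_le_iff₀ hpos] at h2
    linarith

/-- A normalized vector with small segments is normed, up to a factor `2`, by a combination of
segments whose levels all lie beyond a given one. -/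
theorem exists_isLocalComb {x : FinSeq} {a b l : ℕ} (hx : Within a b x)
    (hx1 : lTwo.normingSet.nm x = 1) (hl : ∀ g : Seg, l * |g.fn x| ≤ 1 / 4)
    (h0 : ∀ i, |x i| ≤ 1 / 2) : ∃ l' w, IsLocalComb a b l l' w ∧ 1 / 2 ≤ |w x| := by
  classical
  obtain ⟨w, hw, hwx⟩ := NormingSet.exists_lt_abs (W := lTwo.normingSet) (x := x) (r := 3 / 4)
    (by norm_num) (by rw [hx1]; norm_num)
  rcases hw with ⟨n, rfl⟩ | ⟨ι, _, g, c, N, hc, -, hd, rfl⟩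
  · have := h0 n
    rw [Finsupp.lapply_apply] at hwx
    linarith
  set D : Finset ι := Finset.univ.filter fun i => ∃ j ∈ (g i).lev, j < l with hD
  have hDc : D.card ≤ l := card_le_of_lev_lt hd fun i hi => (Finset.mem_filter.1 hi).2
  have hc2 : ∑ i, c i ^ 2 ≤ 1 := hc
  have hDsum : |∑ i ∈ D, c i * (g i).fn x| ≤ 1 / 4 := by
    rcases D.eq_empty_or_nonempty with h | h
    · rw [h]; simp
    · obtain ⟨i₀, -, hi₀⟩ := Finset.exists_max_image D (fun i => |(g i).fn x|) h
      calc |∑ i ∈ D, c i * (g i).fn x| ≤ ∑ i ∈ D, |(g i₀).fn x| := by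
            refine (Finset.abs_sum_le_sum_abs _ _).trans (Finset.sum_le_sum fun i hi => ?_)
            rw [abs_mul]
            exact (mul_le_of_le_one_left (abs_nonneg _) (lTwo.abs_le _ _ _ hc i)).trans (hi₀ i hi)
        _ = D.card * |(g i₀).fn x| := by rw [Finset.sum_const, nsmul_eq_mul]
        _ ≤ l * |(g i₀).fn x| :=
            mul_le_mul_of_nonneg_right (by exact_mod_cast hDc) (abs_nonneg _)
        _ ≤ 1 / 4 := hl _
  refine ⟨(Finset.univ.sup fun i => (g i).lev.sup id) + 1,
    ∑ i : {i // i ∉ D}, c i • ((g i).restrict a b).fn, ⟨{i // i ∉ D}, inferInstance,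
      fun i => (g i).restrict a b, fun i => c i, ?_, fun i => ⟨le_max_right _ _, min_le_right _ _⟩,
      fun i j hij => hd fun h => hij (Subtype.ext h), fun i j hj => ⟨?_, ?_⟩, rfl⟩, ?_⟩
  · rw [← Finset.sum_subtype (Finset.univ.filter (· ∉ D)) (by simp) fun i => c i ^ 2]
    exact (Finset.sum_le_sum_of_subset_of_nonneg (Finset.filter_subset _ _)
      fun _ _ _ => sq_nonneg _).trans hc2
  · by_contra hjl
    exact i.2 (Finset.mem_filter.2 ⟨Finset.mem_univ _, j, hj, not_le.1 hjl⟩)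
  · refine Nat.lt_succ_of_le ?_
    exact (Finset.le_sup (f := id) (show j ∈ (g i).lev from hj)).trans
      (Finset.le_sup (f := fun i => (g i).lev.sup id) (Finset.mem_univ (i : ι)))
  · rw [LinearMap.sum_apply]
    simp only [Seg.fn_restrict, LinearMap.smul_apply, LinearMap.comp_apply,
      hx.window_eq le_rfl le_rfl, smul_eq_mul]
    rw [← Finset.sum_subtype (Finset.univ.filter (· ∉ D)) (by simp) fun i => c i * (g i).fn x]
    have hsplit : (∑ i, c i • (g i).fn) x = ∑ i ∈ D, c i * (g i).fn x +
        ∑ i ∈ Finset.univ.filter (· ∉ D), c i * (g i).fn x := by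
      rw [LinearMap.sum_apply, ← Finset.sum_filter_add_sum_filter_not Finset.univ (· ∈ D)]
      simp
    rw [hsplit] at hwx
    have := abs_add_le (∑ i ∈ D, c i * (g i).fn x)
      (∑ i ∈ Finset.univ.filter (· ∉ D), c i * (g i).fn x)
    linarith

/-- The data chosen at each step of the construction of a sequence equivalent to the unit vectors
of `ℓ₂`: a vector with its support, a range of levels outside of which it is negligible, a
tolerance, and an almost norming functional. -/
structure Block where
  /-- The vector. -/
  x : FinSeq
  /-- The left end of the support. -/
  a : ℕ
  /-- The right end of the support. -/
  b : ℕ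
  /-- The least level of the range. -/
  l : ℕ
  /-- The end of the range of levels. -/
  l' : ℕ
  /-- The tolerance. -/
  ρ : ℝ
  /-- The almost norming functional. -/
  w : FinSeq →ₗ[ℝ] ℝ

/-- The properties required of the blocks. -/
def IsGoodBlock (V : Submodule ℝ FinSeq) (d : Block) : Prop :=
  d.x ∈ V ∧ Within d.a d.b d.x ∧ lTwo.normingSet.nm d.x = 1 ∧ 0 < d.ρ ∧ d.ρ ≤ 1 / 8 ∧
    (∀ g : Seg, d.l * |g.fn d.x| ≤ d.ρ) ∧
    (∃ B, LevelBound d.x B ∧ ∀ s : Finset ℕ, (∀ j ∈ s, d.l' ≤ j) → ∑ j ∈ s, B j ≤ d.ρ) ∧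
    IsLocalComb d.a d.b d.l d.l' d.w ∧ 1 / 2 ≤ |d.w d.x|

theorem IsLocalComb.mono {a b l l' l'' : ℕ} {w : FinSeq →ₗ[ℝ] ℝ} (h : IsLocalComb a b l l' w)
    (hl : l' ≤ l'') : IsLocalComb a b l l'' w := by
  obtain ⟨ι, hι, g, c, hc, hg, hd, hlev, hw⟩ := h
  exact ⟨ι, hι, g, c, hc, hg, hd, fun i j hj => ⟨(hlev i j hj).1, (hlev i j hj).2.trans_le hl⟩, hw⟩

theorem exists_goodBlock {V : Submodule ℝ FinSeq} (hV : ¬ FiniteDimensional ℝ V) (a l : ℕ) {ρ : ℝ}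
    (hρ : 0 < ρ) (hρ' : ρ ≤ 1 / 8) : ∃ d, IsGoodBlock V d ∧ d.a = a ∧ d.l = l ∧ d.ρ = ρ := by
  set ε := min (ρ / (l + 1)) (wt (code []) / 2) with hε
  have hεpos : 0 < ε := lt_min (by positivity) (half_pos (wt_pos _))
  obtain ⟨x, hxV, b, -, hxb, hx1, hx⟩ := lTwo.exists_small_segments hV a hεpos
  have hl : ∀ g : Seg, l * |g.fn x| ≤ ρ := by
    intro g
    have h1 := (hx g).trans (min_le_left _ _)
    rw [le_div_iff₀ (by positivity)] at h1
    linarith [abs_nonneg (g.fn x)]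
  have h0 : ∀ i, |x i| ≤ 1 / 2 := by
    intro i
    -- The coordinate `i` is, up to its weight, given by a segment with one node.
    have hadm : Admissible [{i}] := ⟨by rw [Finset.card_singleton]; exact sz_pos _, trivial⟩
    have h1 := (hx ⟨[{i}], hadm, 0, a, b⟩).trans (min_le_right _ _)
    rw [Seg.fn, LinearMap.comp_apply, hxb.window_eq le_rfl le_rfl] at h1
    have h2 : treeFn [{i}] 0 x = wt (code []) * x i := by simp [treeFn]
    rw [h2, abs_mul, abs_of_pos (wt_pos _)] at h1
    have h3 := wt_pos (code [])
    by_contra! h4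
    nlinarith
  obtain ⟨l₁, w, hw, hwx⟩ := exists_isLocalComb hxb hx1 (fun g => (hl g).trans (by linarith)) h0
  obtain ⟨B, l₂, hB, hl₂⟩ := exists_high_level x hρ
  exact ⟨⟨x, a, b, l, max l₁ l₂, ρ, w⟩, ⟨hxV, hxb, hx1, hρ, hρ', hl,
    ⟨B, hB, fun s hs => hl₂ s fun j hj => (le_max_right _ _).trans (hs j hj)⟩,
    hw.mono (le_max_left _ _), hwx⟩, rfl, rfl, rfl⟩

/-- Every infinite dimensional subspace of `c₀₀` contains a block sequence equivalent to the unit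
vectors of `ℓ₂`. -/
theorem exists_lTwo_blocks {V : Submodule ℝ FinSeq} (hV : ¬ FiniteDimensional ℝ V) :
    ∃ z : ℕ → FinSeq, (∀ k, z k ∈ V) ∧ ∀ (s : Finset ℕ) (β : ℕ → ℝ),
      1 / 2 * √(∑ k ∈ s, β k ^ 2) ≤ lTwo.normingSet.nm (∑ k ∈ s, β k • z k) ∧
      lTwo.normingSet.nm (∑ k ∈ s, β k • z k) ≤ 2 * √(∑ k ∈ s, β k ^ 2) := by
  obtain ⟨f, hf, hr⟩ := exists_seq_of_forall_finset_exists (IsGoodBlock V)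
    (fun d d' => d.b ≤ d'.a ∧ d.l' ≤ d'.l ∧ d'.ρ ≤ d.ρ / 2) (by
      intro s hs
      obtain ⟨r, hr0, hr1, hrs⟩ := exists_tolerance s Block.ρ (fun d hd => (hs d hd).2.2.2.1)
        (by norm_num : (0 : ℝ) < 1 / 8)
      obtain ⟨d, hd, ha, hl, hρ⟩ := exists_goodBlock hV (s.sup Block.b) (s.sup Block.l') hr0 hr1
      exact ⟨d, hd, fun d' hd' => ⟨ha ▸ Finset.le_sup hd', hl ▸ Finset.le_sup hd',
        hρ ▸ hrs d' hd'⟩⟩)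
  choose hxV hin hx1 hρ0 hρ1 hlow hhigh hw hwx using hf
  have hblock : IsBlockSeq (fun k => (f k).x) (fun k => (f k).a) fun k => (f k).b :=
    ⟨hin, fun m n hmn => (hr m n hmn).1⟩
  refine ⟨fun k => (f k).x, hxV, fun s β => ?_⟩
  set S := √(∑ k ∈ s, β k ^ 2) with hS
  have hnn : 0 ≤ ∑ k ∈ s, β k ^ 2 := Finset.sum_nonneg fun _ _ => sq_nonneg _
  have hS0 : 0 ≤ S := Real.sqrt_nonneg _
  have hS2 : S ^ 2 = ∑ k ∈ s, β k ^ 2 := Real.sq_sqrt hnn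
  have hβS : ∀ k ∈ s, |β k| ≤ S := fun k hk => by
    refine Real.abs_le_sqrt ?_
    exact Finset.single_le_sum (f := fun k => β k ^ 2) (fun _ _ => sq_nonneg _) hk
  constructor
  · rcases hS0.eq_or_lt with h0 | hpos
    · rw [← h0, mul_zero]; exact NormingSet.nm_nonneg _ _
    set γ : ℕ → ℝ := fun k => β k * SignType.sign ((f k).w (f k).x) / S with hγ
    have hcomb := isComb_sum_of_isLocalComb hw (fun m n hmn => (hr m n hmn).2.1) s γ (by
      calc ∑ k ∈ s, γ k ^ 2 ≤ ∑ k ∈ s, β k ^ 2 / S ^ 2 := by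
            refine Finset.sum_le_sum fun k _ => ?_
            rw [hγ]
            simp only
            rw [div_pow, mul_pow]
            refine div_le_div_of_nonneg_right (mul_le_of_le_one_right (sq_nonneg _) ?_)
              (sq_nonneg _)
            rcases lt_trichotomy ((f k).w (f k).x) 0 with h | h | h <;> simp [h]
        _ = 1 := by rw [← Finset.sum_div, ← hS2, div_self (pow_pos hpos 2).ne'])
    have h1 := NormingSet.abs_le_nm hcomb.mem (∑ k ∈ s, β k • (f k).x)
    have h2 : (∑ k ∈ s, γ k • (f k).w) (∑ k ∈ s, β k • (f k).x) =
        ∑ k ∈ s, β k ^ 2 * |(f k).w (f k).x| / S := by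
      rw [LinearMap.sum_apply]
      refine Finset.sum_congr rfl fun k hk => ?_
      rw [LinearMap.smul_apply, map_sum, Finset.sum_eq_single k]
      · rw [map_smul, smul_eq_mul, smul_eq_mul, ← sign_mul_self, hγ]; ring
      · intro m _ hmk
        rw [map_smul, (hw k).apply_eq_zero (hin m), smul_zero]
        rcases lt_or_gt_of_ne hmk with h | h
        · exact Or.inl (hr _ _ h).1
        · exact Or.inr (hr _ _ h).1
      · exact fun h => absurd hk h
    rw [h2] at h1
    refine le_trans ?_ ((le_abs_self _).trans h1)
    calc 1 / 2 * S = ∑ k ∈ s, β k ^ 2 * (1 / 2) / S := by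
          rw [← Finset.sum_div, ← Finset.sum_mul, ← hS2]; field_simp
      _ ≤ ∑ k ∈ s, β k ^ 2 * |(f k).w (f k).x| / S := Finset.sum_le_sum fun k _ =>
          div_le_div_of_nonneg_right (mul_le_mul_of_nonneg_left (hwx k) (sq_nonneg _)) hS0
  · refine NormingSet.nm_le (by linarith) ?_
    rintro w (⟨n, rfl⟩ | hwc)
    · rw [Finsupp.lapply_apply]
      have h1 : ∑ k ∈ s, β k • (f k).x = ∑ k ∈ s, (if k ∈ s then β k else 0) • (f k).x :=
        Finset.sum_congr rfl fun k hk => by rw [if_pos hk]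
      rw [h1]
      refine (hblock.abs_sum_apply_le (W := lTwo.normingSet) hx1 (D := S) (fun k => ?_) n).trans
        (by linarith)
      split_ifs with h
      · exact hβS k h
      · simpa using hS0
    · obtain ⟨ι, _, g, c, N, hc, -, hd, rfl⟩ := hwc
      classical
      have hc2 : ∑ i, c i ^ 2 ≤ 1 := hc
      have hc1 : ∀ i, |c i| ≤ 1 := lTwo.abs_le _ _ _ hc
      -- The segments are split according to whether they have a level below `l`, a level below
      -- `l'` but none below `l`, or no level below `l'`.
      set D : ℕ → Finset ι := fun k => Finset.univ.filter fun i => ∃ j ∈ (g i).lev, j < (f k).l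
        with hD
      set E : ℕ → Finset ι := fun k => Finset.univ.filter fun i => (∃ j ∈ (g i).lev, j < (f k).l') ∧
        ¬ ∃ j ∈ (g i).lev, j < (f k).l with hE
      set γ : ℕ → ℝ := fun k => √(∑ i ∈ E k, c i ^ 2) with hγ
      have hEdisj : ∀ m n, m ≠ n → Disjoint (E m) (E n) := by
        have : ∀ m n, m < n → Disjoint (E m) (E n) := by
          intro m n hmn
          refine Finset.disjoint_left.2 fun i hi hi' => ?_
          obtain ⟨j, hj, hjl⟩ := (Finset.mem_filter.1 hi).2.1
          exact (Finset.mem_filter.1 hi').2.2 ⟨j, hj, hjl.trans_le (hr m n hmn).2.1⟩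
        intro m n hmn
        rcases lt_or_gt_of_ne hmn with h | h
        exacts [this _ _ h, (this _ _ h).symm]
      have hγ2 : ∑ k ∈ s, γ k ^ 2 ≤ 1 := by
        have h1 : ∀ k, γ k ^ 2 = ∑ i ∈ E k, c i ^ 2 := fun k =>
          Real.sq_sqrt (Finset.sum_nonneg fun _ _ => sq_nonneg _)
        simp only [h1]
        rw [← Finset.sum_biUnion fun m _ n _ hmn => hEdisj m n hmn]
        exact (Finset.sum_le_sum_of_subset_of_nonneg (Finset.subset_univ _)
          fun _ _ _ => sq_nonneg _).trans hc2
      have hterm : ∀ k, |(∑ i, c i • (g i).fn) (f k).x| ≤ γ k + 2 * (f k).ρ := by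
        intro k
        have hDk : |∑ i ∈ D k, c i * (g i).fn (f k).x| ≤ (f k).ρ := by
          have hcard : (D k).card ≤ (f k).l :=
            card_le_of_lev_lt hd fun i hi => (Finset.mem_filter.1 hi).2
          rcases (D k).eq_empty_or_nonempty with h | h
          · rw [h]; simpa using (hρ0 k).le
          · obtain ⟨i₀, -, hi₀⟩ := Finset.exists_max_image (D k) (fun i => |(g i).fn (f k).x|) h
            calc |∑ i ∈ D k, c i * (g i).fn (f k).x| ≤ ∑ i ∈ D k, |(g i₀).fn (f k).x| := by
                  refine (Finset.abs_sum_le_sum_abs _ _).trans (Finset.sum_le_sum fun i hi => ?_)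
                  rw [abs_mul]
                  exact (mul_le_of_le_one_left (abs_nonneg _) (hc1 i)).trans (hi₀ i hi)
              _ = (D k).card * |(g i₀).fn (f k).x| := by rw [Finset.sum_const, nsmul_eq_mul]
              _ ≤ (f k).l * |(g i₀).fn (f k).x| :=
                  mul_le_mul_of_nonneg_right (by exact_mod_cast hcard) (abs_nonneg _)
              _ ≤ (f k).ρ := hlow k _
        have hEk : |∑ i ∈ E k, c i * (g i).fn (f k).x| ≤ γ k := by
          have := abs_sum_smul_fn_le hd c (E k) (f k).x
          rwa [hx1 k, mul_one] at this
        set F : Finset ι := Finset.univ.filter fun i => ¬ (∃ j ∈ (g i).lev, j < (f k).l') ∧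
          ¬ ∃ j ∈ (g i).lev, j < (f k).l with hF
        have hFk : |∑ i ∈ F, c i * (g i).fn (f k).x| ≤ (f k).ρ := by
          obtain ⟨B, hB, hBs⟩ := hhigh k
          calc |∑ i ∈ F, c i * (g i).fn (f k).x| ≤ ∑ i ∈ F, |(g i).fn (f k).x| := by
                refine (Finset.abs_sum_le_sum_abs _ _).trans (Finset.sum_le_sum fun i _ => ?_)
                rw [abs_mul]
                exact mul_le_of_le_one_left (abs_nonneg _) (hc1 i)
            _ ≤ ∑ j ∈ F.biUnion fun i => (g i).lev, B j := sum_abs_fn_le hd hB F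
            _ ≤ (f k).ρ := by
                refine hBs _ fun j hj => ?_
                obtain ⟨i, hi, hij⟩ := Finset.mem_biUnion.1 hj
                by_contra hlt
                exact (Finset.mem_filter.1 hi).2.1 ⟨j, hij, not_le.1 hlt⟩
        have hsplit : (∑ i, c i • (g i).fn) (f k).x = ∑ i ∈ D k, c i * (g i).fn (f k).x +
            (∑ i ∈ E k, c i * (g i).fn (f k).x + ∑ i ∈ F, c i * (g i).fn (f k).x) := by
          rw [LinearMap.sum_apply, ← Finset.sum_filter_add_sum_filter_not Finset.univ
            (fun i => ∃ j ∈ (g i).lev, j < (f k).l)]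
          congr 1
          rw [← Finset.sum_filter_add_sum_filter_not (Finset.univ.filter
            fun i => ¬ ∃ j ∈ (g i).lev, j < (f k).l) (fun i => ∃ j ∈ (g i).lev, j < (f k).l')]
          congr 1 <;> refine Finset.sum_congr ?_ fun _ _ => rfl <;> ext i <;>
            simp [hE, hF, and_comm]
        rw [hsplit]
        have h1 := abs_add_le (∑ i ∈ D k, c i * (g i).fn (f k).x)
          (∑ i ∈ E k, c i * (g i).fn (f k).x + ∑ i ∈ F, c i * (g i).fn (f k).x)
        have h2 := abs_add_le (∑ i ∈ E k, c i * (g i).fn (f k).x)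
          (∑ i ∈ F, c i * (g i).fn (f k).x)
        linarith
      have hρsum := sum_le_of_halving (ρ := fun k => (f k).ρ) (c := 1 / 8) hρ1
        (fun k => (hρ0 k).le) (fun m n hmn => (hr m n hmn).2.2) s
      have hCS : ∑ k ∈ s, |β k| * γ k ≤ S := by
        refine (Real.sum_mul_le_sqrt_mul_sqrt s (fun k => |β k|) γ).trans ?_
        simp only [sq_abs]
        refine mul_le_of_le_one_right hS0 ?_
        exact Real.sqrt_le_one.2 hγ2
      rw [map_sum]
      calc |∑ k ∈ s, (∑ i, c i • (g i).fn) (β k • (f k).x)|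
          ≤ ∑ k ∈ s, (|β k| * γ k + S * (2 * (f k).ρ)) := by
            refine (Finset.abs_sum_le_sum_abs _ _).trans (Finset.sum_le_sum fun k hk => ?_)
            rw [map_smul, smul_eq_mul, abs_mul]
            refine (mul_le_mul_of_nonneg_left (hterm k) (abs_nonneg _)).trans ?_
            rw [mul_add]
            have := mul_le_mul_of_nonneg_right (hβS k hk)
              (mul_nonneg zero_le_two (hρ0 k).le)
            linarith
        _ = ∑ k ∈ s, |β k| * γ k + S * (2 * ∑ k ∈ s, (f k).ρ) := by
            rw [Finset.sum_add_distrib, ← Finset.mul_sum, ← Finset.mul_sum]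
        _ ≤ 2 * S := by nlinarith

end CoefClass

/-- The inclusion of `c₀₀` in `ℓ₂`. -/
noncomputable def toSeqEllTwo : FinSeq →ₗ[ℝ] SeqEllTwo :=
  Finsupp.linearCombination ℝ fun k => (lp.single 2 k (1 : ℝ) : SeqEllTwo)

theorem toSeqEllTwo_eq_sum (a : FinSeq) :
    toSeqEllTwo a = ∑ k ∈ a.support, (lp.single 2 k (a k) : SeqEllTwo) := by
  rw [toSeqEllTwo, Finsupp.linearCombination_apply, Finsupp.sum]
  refine Finset.sum_congr rfl fun k _ => ?_
  rw [← lp.single_smul, smul_eq_mul, mul_one]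

theorem norm_toSeqEllTwo (a : FinSeq) : ‖toSeqEllTwo a‖ = √(∑ k ∈ a.support, a k ^ 2) := by
  have h := lp.norm_sum_single (p := 2) (E := fun _ : ℕ => ℝ) (by norm_num) a a.support
  rw [← toSeqEllTwo_eq_sum] at h
  simp only [ENNReal.toReal_ofNat, Real.rpow_ofNat, Real.norm_eq_abs, sq_abs] at h
  rw [← h, Real.sqrt_sq (norm_nonneg _)]

theorem denseRange_toSeqEllTwo : DenseRange toSeqEllTwo := by
  intro f
  refine mem_closure_of_tendsto (lp.hasSum_single (by norm_num) f)
    (Eventually.of_forall fun s => ?_)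
  refine ⟨∑ k ∈ s, Finsupp.single k (f k), ?_⟩
  rw [map_sum]
  refine Finset.sum_congr rfl fun k _ => ?_
  rw [toSeqEllTwo, Finsupp.linearCombination_single, ← lp.single_smul, smul_eq_mul, mul_one]

theorem CoefClass.isSaturatedBy_lTwo :
    IsSaturatedBy SeqEllTwo CoefClass.lTwo.normingSet.Space := by
  refine NormingSet.isSaturatedBy_of_forall_submodule _ toSeqEllTwo denseRange_toSeqEllTwo
    fun V hV => ?_
  obtain ⟨z, hzV, hz⟩ := CoefClass.exists_lTwo_blocks hV
  refine ⟨Finsupp.linearCombination ℝ z, 1 / 2, 2, one_half_pos, fun a => ?_, fun a => ?_,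
    fun a => ?_⟩ <;> rw [Finsupp.linearCombination_apply, Finsupp.sum]
  · exact V.sum_mem fun k _ => V.smul_mem _ (hzV k)
  · rw [norm_toSeqEllTwo]; exact (hz _ _).1
  · rw [norm_toSeqEllTwo]; exact (hz _ _).2

theorem mainTheorem12 :
    (∃ (X : Type) (_ : NormedAddCommGroup X) (_ : NormedSpace ℝ X) (_ : CompleteSpace X)
      (e : SchauderBasis ℝ X),
      (∀ n, ‖e n‖ = 1) ∧ IsWeaklyNull (fun n => e n) ∧ IsSaturatedBy SeqEllTwo X ∧
      ∀ M : Set ℕ, M.Infinite →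
        ¬ TopologicalSpace.SeparableSpace (StrongDual ℝ (closedSpan (fun n => e n) M))) ∧
    (∃ (X : Type) (_ : NormedAddCommGroup X) (_ : NormedSpace ℝ X) (_ : CompleteSpace X)
      (e : SchauderBasis ℝ X),
      (∀ n, ‖e n‖ = 1) ∧ IsWeaklyNull (fun n => e n) ∧ IsSaturatedBy SeqCZero X ∧
      ∀ M : Set ℕ, M.Infinite →
        ¬ TopologicalSpace.SeparableSpace (StrongDual ℝ (closedSpan (fun n => e n) M))) :=
  ⟨⟨CoefClass.lTwo.normingSet.Space, inferInstance, inferInstance, inferInstance,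
      CoefClass.lTwo.normingSet.basis, NormingSet.norm_basis _,
      CoefClass.isWeaklyNull_basis _, CoefClass.isSaturatedBy_lTwo,
      fun _ hM => CoefClass.not_separableSpace_dual_closedSpan _ hM⟩,
    ⟨CoefClass.cZero.normingSet.Space, inferInstance, inferInstance, inferInstance,
      CoefClass.cZero.normingSet.basis, NormingSet.norm_basis _,
      CoefClass.isWeaklyNull_basis _, CoefClass.isSaturatedBy_cZero,
      fun _ hM => CoefClass.not_separableSpace_dual_closedSpan _ hM⟩⟩
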